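/- **Setting.** Let $\mathbb{Q}(i)\subset K\subset\mathbb{C}$ with $K/\mathbb{Q}(i)$ a Galois extension of degree $n$ with cyclic Galois group, let $g$ be a generator of this group, and let $\sigma:\mathcal{O}_K\to\mathbb{C}^n$, $\sigma(x)=(x,g(x),\dots,g^{n-1}(x))$. Let $p$ be a rational prime that splits in $K$ (there are $2n$ primes of $\mathcal{O}_K$ above $p$), $\mathfrak{p}$ a prime of $\mathcal{O}_K$ above $p$, and $\phi:\mathcal{O}_K/\mathfrak{p}\to\mathbb{F}_p$ an isomorphism. Put $\rho(x)=\big(\phi(g^{j}(x)\bmod\mathfrak{p})\big)_{0\le j<n}\in\mathbb{F}_p^n$ for $x \in \mathcal{O}_K$. For a linear code $\mathcal{C}\subset\mathbb{F}_p^n$ of dimension $k$ put $\Lambda_K(\mathcal{C})=\sigma(\rho^{-1}(\mathcal{C}))$, a lattice in $\mathbb{C}^n$ of volume $2^{-n}p^{n-k}\sqrt{|\Delta_K|}$, where $\Delta_K$ is the discriminant of $K$. For $\beta>0$ let $\mathbb{L}_{K,n,k,p,\beta}$ be the set of all lattices $\alpha\Lambda_K(\mathcal{C})$ obtained in this way from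 $(n,k)$ codes over $\mathbb{F}_p$ (and primes $\mathfrak p$ above $p$), where $\alpha=\big(\beta\,2^{-n}p^{n-k}\sqrt{|\Delta_K|}\big)^{-1/(2n)}$ normalizes the volume to $1/\beta$. Let $(h_i)_{i\ge1}$ be a complex random process such that, for every $i$, $h_i\neq0$ almost surely, $\log|h_i|$ is integrable and $E[\log|h_i|]=\mu$, and such that $\frac1n\sum_{i=1}^n\log|h_i|\to\mu$ in probability (for instance, a stationary ergodic process with $\log|h_1|$ integrable and $E[\log|h_1|]=\mu$). In the channel $y_i=h_ix_i+z_i$, the $z_i$ are i.i.d. $\mathcal{CN}(0,s^2)$ and independent of $(h_i)$. For a full-rank lattice $\Lambda\subset\mathbb{C}^n$ let $V(\Lambda)$ be its volume as a lattice of $\mathbb{R}^{2n}$, let its volume-to-noise ratio (VNR) be $\gamma_\Lambda(s)=V(\Lambda)^{1/n}/s^2$, and let $P_e(\Lambda,s)=E_{\mathbf H}\big[P(\mathbf z\notin\mathcal{V}_{\mathbf H\Lambda})\big]$ be the error probability of lattice decoding, where $\mathbf H=\mathrm{diag}(h_1,\dots,h_n)$ and $\mathcal{V}_{\mathbf H\Lambda}=\{\mathbf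 y:\|\mathbf y\|\le\|\mathbf v-\mathbf y\|\ \text{for all }\mathbf v\in\mathbf H\Lambda\}$ is the Voronoi region of $\mathbf 0$. A sequence of full-rank lattices $\Lambda_j\subset\mathbb{C}^{n_j}$, with $n_1<n_2<\cdots$, is *good for the ergodic fading channel* if for every $\gamma>e^{-2\mu}\pi e$ and all $s_j>0$ with $\gamma_{\Lambda_j}(s_j)\ge\gamma$ for every $j$, $P_e(\Lambda_j,s_j)\to0$ as $j\to\infty$. **Theorem.** Let $(h_i)$ and $\mu$ be as above, let $\beta>0$, let $n_1<n_2<\cdots$ be integers and let $0<k_j<n_j$. Then for every $j$ there is a cyclic extension of $\mathbb{Q}(i)$ of degree $n_j$ as above, and for every choice of such extensions $K_j/\mathbb{Q}(i)$ of degree $n_j$ (with generators of their Galois groups) there are primes $p_j$ that split in $K_j$ and lattices $\Lambda_j\in\mathbb{L}_{K_j,n_j,k_j,p_j,\beta}$ such that the sequence $(\Lambda_j)$ is good for the ergodic fading channel: for all VNR above $e^{-2\mu}\pi e$, the error probability tends to $0$. In particular, there exists a sequence of ergodic fading-good lattices from this generalized Construction A ensemble. -/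

import Mathlib

open MeasureTheory ProbabilityTheory Filter Topology NumberField
open scoped Pointwise

noncomputable section

/-! ### Lattices in `ℂⁿ` -/

/-- Full-rank lattices in `ℂⁿ`: discrete additive subgroups that span `ℂⁿ` over `ℝ`. -/
def IsFullLattice {n : ℕ} (L : Submodule ℤ (Fin n → ℂ)) : Prop :=
  DiscreteTopology L ∧ Submodule.span ℝ (L : Set (Fin n → ℂ)) = ⊤

/-- The square of the Euclidean norm of a vector of `ℂⁿ`. -/
def sqNorm {n : ℕ} (x : Fin n → ℂ) : ℝ := ∑ i, ‖x i‖ ^ 2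

/-- The Voronoi region of the point `x` of `L`. -/
def voronoiRegion {n : ℕ} (L : Set (Fin n → ℂ)) (x : Fin n → ℂ) : Set (Fin n → ℂ) :=
  {y | ∀ x' ∈ L, sqNorm (x - y) ≤ sqNorm (x' - y)}

/-- The volume-to-noise ratio `V(L)^{1/n} / s²`, the volume being that of `L` as a lattice of
rank `2n` in `ℝ²ⁿ`. -/
def vnr {n : ℕ} (L : Submodule ℤ (Fin n → ℂ)) (s : ℝ) : ℝ :=
  (ZLattice.covolume L) ^ (1 / (n : ℝ)) / s ^ 2

/-! ### The fading channel -/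

/-- The law `𝒞𝒩(0, s²)`: independent real and imaginary parts, each `𝒩(0, s²/2)`. -/
def complexGaussian (s : ℝ) : Measure ℂ :=
  ((gaussianReal 0 (Real.toNNReal (s ^ 2 / 2))).prod
    (gaussianReal 0 (Real.toNNReal (s ^ 2 / 2)))).map Complex.measurableEquivRealProd.symm

/-- The law of `n` independent `𝒞𝒩(0, s²)` variables. -/
def noise (n : ℕ) (s : ℝ) : Measure (Fin n → ℂ) :=
  Measure.pi fun _ => complexGaussian s

/-- The faded lattice `H L`, where `H = diag (c 0, …, c (n-1))`. -/
def faded {n : ℕ} (c : ℕ → ℂ) (L : Submodule ℤ (Fin n → ℂ)) : Set (Fin n → ℂ) :=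
  (fun x i => c i * x i) '' (L : Set (Fin n → ℂ))

/-- The error probability of lattice decoding in the channel `y = H x + z`, where `x ∈ L`, the
noise `z` is independent of `H`, and `H` is known to the receiver:
`E_H [P (z ∉ 𝒱_{H L}(0))]`. -/
def errorProb {Ω : Type*} [MeasurableSpace Ω] (P : Measure Ω) (h : ℕ → Ω → ℂ)
    {n : ℕ} (L : Submodule ℤ (Fin n → ℂ)) (s : ℝ) : ENNReal :=
  ∫⁻ ω, noise n s (voronoiRegion (faded (fun i => h i ω) L) 0)ᶜ ∂P

/-- `h` is a fading process with `μ = E[log |h|]` finite (in particular, the fading coefficients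
are almost surely non-zero), and the empirical means of `log |h i|` converge to `μ` in
probability. -/
structure IsErgodicFading {Ω : Type*} [MeasurableSpace Ω] (P : Measure Ω)
    (h : ℕ → Ω → ℂ) (μ : ℝ) : Prop where
  measurable : ∀ i, Measurable (h i)
  ne_zero : ∀ i, ∀ᵐ ω ∂P, h i ω ≠ 0
  integrable : ∀ i, Integrable (fun ω => Real.log ‖h i ω‖) P
  mean : ∀ i, ∫ ω, Real.log ‖h i ω‖ ∂P = μ
  weak_law : ∀ ε : ℝ, 0 < ε → Tendsto
    (fun n : ℕ => P {ω | ε < |(1 / (n : ℝ)) * ∑ i ∈ Finset.range n, Real.log ‖h i ω‖ - μ|})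
    atTop (𝓝 0)

/-- A sequence of lattices `L j ⊂ ℂ^(n j)` of increasing dimension is good for the ergodic fading
channel `h` if the error probability tends to `0` as soon as the volume-to-noise ratio stays
above a constant `γ > e^{-2μ} π e`. -/
structure FadingGood {Ω : Type*} [MeasurableSpace Ω] (P : Measure Ω)
    (h : ℕ → Ω → ℂ) (μ : ℝ) (n : ℕ → ℕ) (L : ∀ j, Submodule ℤ (Fin (n j) → ℂ)) : Prop where
  dim : StrictMono n
  lattice : ∀ j, IsFullLattice (L j)
  good : ∀ γ : ℝ, Real.exp (-2 * μ) * (Real.pi * Real.exp 1) < γ →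
    ∀ s : ℕ → ℝ, (∀ j, 0 < s j) → (∀ j, γ ≤ vnr (L j) (s j)) →
      Tendsto (fun j => errorProb P h (L j) (s j)) atTop (𝓝 0)

/-! ### Generalized Construction A over cyclic extensions of `ℚ(i)` -/

/-- The field `ℚ(i)`. -/
abbrev GaussianField : IntermediateField ℚ ℂ := IntermediateField.adjoin ℚ {Complex.I}

instance : FiniteDimensional ℚ GaussianField :=
  IntermediateField.adjoin.finiteDimensional
    (IsIntegral.of_pow (n := 4) (by norm_num) (by rw [Complex.I_pow_four]; exact isIntegral_one))

instance : NumberField GaussianField where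

/-- A relative extension `K / ℚ(i)` inside `ℂ`, Galois of degree `n` with cyclic Galois group,
together with a generator of its Galois group. -/
structure CyclicExtension (n : ℕ) where
  K : IntermediateField GaussianField ℂ
  finiteDimensional : FiniteDimensional GaussianField K
  isGalois : IsGalois GaussianField K
  finrank_eq : Module.finrank GaussianField K = n
  gen : K ≃ₐ[GaussianField] K
  gen_spec : ∀ g : K ≃ₐ[GaussianField] K, g ∈ Subgroup.zpowers gen

namespace CyclicExtension

variable {n : ℕ} (E : CyclicExtension n)

instance : FiniteDimensional GaussianField E.K := E.finiteDimensional

instance : IsGalois GaussianField E.K := E.isGalois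

instance : NumberField E.K := NumberField.of_module_finite GaussianField E.K

/-- The relative embedding `gen ^ i`, as a map `𝓞 K → 𝓞 K`. -/
def relEmb (i : ℕ) : 𝓞 E.K →+* 𝓞 E.K :=
  RingOfIntegers.mapRingHom ((E.gen ^ i : E.K ≃ₐ[GaussianField] E.K) : E.K →+* E.K)

/-- The canonical embedding `x ↦ (x, gen x, …, gen^(n-1) x)` of `𝓞 K` into `ℂⁿ`. -/
def canonicalEmb : 𝓞 E.K →+* (Fin n → ℂ) :=
  RingHom.pi fun i => (algebraMap E.K ℂ).comp ((algebraMap (𝓞 E.K) E.K).comp (E.relEmb i))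

/-- The rational prime `p` splits (completely) in `K`: the number of primes of `𝓞 K` above `p` is
the absolute degree `2n` of `K`. -/
def Splits (p : ℕ) : Prop :=
  (Ideal.primesOver (Ideal.span {(p : ℤ)}) (𝓞 E.K)).ncard = 2 * n

/-- The reduction `ρ : 𝓞 K → 𝔽_pⁿ`, obtained by applying `𝓞 K → 𝓞 K / 𝔭 ≃ 𝔽_p` to each coordinate
of the canonical embedding. -/
def reduction {p : ℕ} (𝔭 : Ideal (𝓞 E.K)) (φ : (𝓞 E.K ⧸ 𝔭) ≃+* ZMod p) :
    𝓞 E.K →+* (Fin n → ZMod p) :=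
  RingHom.pi fun i => (φ : (𝓞 E.K ⧸ 𝔭) →+* ZMod p).comp
    ((Ideal.Quotient.mk 𝔭).comp (E.relEmb i))

/-- The Construction A lattice of a linear code `C ⊆ 𝔽_pⁿ`: the embedded preimage of `C` under the
reduction. -/
def constructionA {p : ℕ} (𝔭 : Ideal (𝓞 E.K)) (φ : (𝓞 E.K ⧸ 𝔭) ≃+* ZMod p)
    (C : Submodule (ZMod p) (Fin n → ZMod p)) : Submodule ℤ (Fin n → ℂ) :=
  AddSubgroup.toIntSubmodule
    ((C.toAddSubgroup.comap (E.reduction 𝔭 φ).toAddMonoidHom).map E.canonicalEmb.toAddMonoidHom)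

/-- The factor that normalizes the volume `2⁻ⁿ p^(n-k) √|Δ_K|` of a Construction A lattice in `ℂⁿ`
to `1/β`. -/
def normFactor (k p : ℕ) (β : ℝ) : ℝ :=
  (β * (2⁻¹ ^ n * (p : ℝ) ^ ((n : ℝ) - k) * √|(discr E.K : ℝ)|)) ^ (-(1 / (2 * (n : ℝ))))

/-- The ensemble of normalized Construction A lattices of `(n, k)` codes over `𝔽_p`, for a prime
`p` that splits in `K` and a prime `𝔭` above it. -/
def ensemble (k p : ℕ) (β : ℝ) : Set (Submodule ℤ (Fin n → ℂ)) :=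
  {L | p.Prime ∧ E.Splits p ∧
    ∃ 𝔭 ∈ Ideal.primesOver (Ideal.span {(p : ℤ)}) (𝓞 E.K),
    ∃ φ : (𝓞 E.K ⧸ 𝔭) ≃+* ZMod p,
    ∃ C : Submodule (ZMod p) (Fin n → ZMod p), Module.finrank (ZMod p) C = k ∧
      L = E.normFactor k p β • E.constructionA 𝔭 φ C}

end CyclicExtension

end

/-! ### Existence of cyclic extensions of `ℚ(i)` -/

/-! The core is a Minkowski–Hlawka averaging argument in each dimension. Fix fading with all `|h_i|`
in `[B⁻¹, B]` and noise with `‖z‖² < R`, where `R = n s² (1 + δ)`. A decoding error requires a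
nonzero lattice point `x` with `‖H x - z‖² < R`, so `x` lies in an ellipsoid of volume at most
`(πeR/n)ⁿ / ∏ |h_i|²` (`volume_sqNorm_le`).

The codes run through the images of one `k`-dimensional subspace of the field with `pⁿ` elements
under multiplication by units (`exists_balanced_codes`), so a point with nonzero residues lies in a
proportion at most `(p^k - 1)/(pⁿ - 1)` of the codes. A nonzero integer with zero residues has norm
divisible by `pⁿ`, hence a conjugate of size at least `√p`, which puts it outside the ellipsoid when
`p` is large (`pow_le_of_reduction_eq_zero`). As `p` grows the scaled integer lattice becomes fine,
so its points in the ellipsoid number at most the volume of a slightly larger ellipsoid divided by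
the covolume (`exists_packing_bound`). Altogether the average error is at most `(πe(1+δ)² /
(e^{2(μ-ε)} γ))ⁿ` plus the probabilities of large noise, of extreme fading, and of `∏ |h_i|² <
e^{2n(μ-ε)}`. Chernoff's bound, truncation and the weak law control these, and the base is below `1`
for small `δ, ε` exactly when `γ > e^{-2μ}πe`.

Two uniformities remain. One lattice serves every noise level because Voronoi regions are
star-shaped, so the error increases with `s` (`errorProb_mono`). One sequence serves every `γ` above
the threshold by a diagonal choice (`exists_diagonal`).

On the arithmetic side, cyclic extensions come from cyclotomic fields of prime conductor, and split
primes from degree one primes of the normal closure, without Chebotarev's theorem. -/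

theorem isPrimitiveRoot_I : IsPrimitiveRoot Complex.I 4 := by
  convert Complex.isPrimitiveRoot_exp 4 (by norm_num) using 1
  rw [show 2 * (Real.pi : ℂ) * Complex.I / ((4 : ℕ) : ℂ) = Real.pi / 2 * Complex.I by
    push_cast; ring, Complex.exp_pi_div_two_mul_I]

theorem finrank_gaussianField : Module.finrank ℚ GaussianField = 2 := by
  have hint : IsIntegral ℚ Complex.I :=
    IsIntegral.of_pow (n := 4) (by norm_num) (by rw [Complex.I_pow_four]; exact isIntegral_one)
  rw [IntermediateField.adjoin.finrank hint]
  rw [← Polynomial.cyclotomic_eq_minpoly_rat isPrimitiveRoot_I (by norm_num),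
    Polynomial.natDegree_cyclotomic]
  decide

/-- A subgroup of prescribed index in a finite cyclic Galois group yields a cyclic subextension of
prescribed degree. -/
theorem exists_cyclicExtension_of_dvd {n : ℕ} (hn : 0 < n) (M : IntermediateField GaussianField ℂ)
    [FiniteDimensional GaussianField M] [IsGalois GaussianField M]
    [IsCyclic (M ≃ₐ[GaussianField] M)] (h : n ∣ Module.finrank GaussianField M) :
    Nonempty (CyclicExtension n) := by
  obtain ⟨g, hg⟩ := IsCyclic.exists_generator (α := M ≃ₐ[GaussianField] M)
  let _ : CommGroup (M ≃ₐ[GaussianField] M) := IsCyclic.commGroup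
  let H : Subgroup (M ≃ₐ[GaussianField] M) := Subgroup.zpowers (g ^ n)
  have hcard : Nat.card (M ≃ₐ[GaussianField] M) = Module.finrank GaussianField M :=
    IsGalois.card_aut_eq_finrank _ _
  have hog : orderOf g = Module.finrank GaussianField M := by
    rw [orderOf_eq_card_of_forall_mem_zpowers hg, hcard]
  have hpos : 0 < Module.finrank GaussianField M := Module.finrank_pos
  have hH : Nat.card H = Module.finrank GaussianField M / n := by
    rw [Nat.card_zpowers, orderOf_pow_of_dvd hn.ne' (hog ▸ h), hog]
  have : H.Normal := inferInstance
  let L := IntermediateField.fixedField H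
  have hL : Module.finrank GaussianField L = n := by
    have h1 := Module.finrank_mul_finrank GaussianField L M
    have h2 : Module.finrank L M = Nat.card H := IntermediateField.finrank_fixedField_eq_card H
    obtain ⟨m, hm⟩ := h
    rw [h2, hH, hm, Nat.mul_div_cancel_left _ hn] at h1
    have hm0 : 0 < m := Nat.pos_of_ne_zero (by rintro rfl; omega)
    exact Nat.eq_of_mul_eq_mul_right hm0 h1
  have : IsGalois GaussianField L := IsGalois.of_fixedField_normal_subgroup H
  have hcyc : IsCyclic (L ≃ₐ[GaussianField] L) :=
    isCyclic_of_surjective (AlgEquiv.restrictNormalHom (F := GaussianField) (K₁ := M) L)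
      (AlgEquiv.restrictNormalHom_surjective M)
  let K := IntermediateField.lift L
  let e : L ≃ₐ[GaussianField] K := IntermediateField.liftAlgEquiv L
  have hcycK : IsCyclic (K ≃ₐ[GaussianField] K) :=
    isCyclic_of_surjective e.autCongr.toMonoidHom e.autCongr.surjective
  obtain ⟨gen, hgen⟩ := IsCyclic.exists_generator (α := K ≃ₐ[GaussianField] K)
  exact ⟨⟨K, Module.Finite.equiv e.toLinearEquiv, IsGalois.of_algEquiv e,
    by rw [← e.toLinearEquiv.finrank_eq, hL], gen, hgen⟩⟩

/-- For a prime `q ≡ 1 mod n` with `q > 2`, adjoining a `q`-th root of unity to `ℚ(i)` gives a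
cyclic extension of degree `q - 1`, a multiple of `n`. -/
theorem nonempty_cyclicExtension {n : ℕ} (hn : 0 < n) : Nonempty (CyclicExtension n) := by
  obtain ⟨q, hq, hq2, hqn⟩ := Nat.exists_prime_gt_modEq_one 2 hn.ne'
  have : Fact q.Prime := ⟨hq⟩
  have : NeZero q := ⟨hq.ne_zero⟩
  have hζ := Complex.isPrimitiveRoot_exp q hq.ne_zero
  set ζ := Complex.exp (2 * Real.pi * Complex.I / q)
  have hintζ : IsIntegral GaussianField ζ :=
    IsIntegral.of_pow hq.pos (by rw [hζ.pow_eq_one]; exact isIntegral_one)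
  let M := IntermediateField.adjoin GaussianField {ζ}
  have hcyc : IsCyclotomicExtension {q} GaussianField M := by
    change IsCyclotomicExtension {q} GaussianField M.toSubalgebra
    rw [IntermediateField.adjoin_simple_toSubalgebra_of_isAlgebraic hintζ.isAlgebraic]
    exact hζ.adjoin_isCyclotomicExtension GaussianField
  have hfin : FiniteDimensional GaussianField M := IntermediateField.adjoin.finiteDimensional hintζ
  have hgal : IsGalois GaussianField M := IsCyclotomicExtension.isGalois {q} GaussianField M
  have hζM := IsCyclotomicExtension.zeta_spec q GaussianField M
  have : IsCyclic (M ≃ₐ[GaussianField] M) :=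
    isCyclic_of_injective (hζM.autToPow GaussianField) (hζM.autToPow_injective GaussianField)
  have hle : Module.finrank GaussianField M ≤ q - 1 := by
    rw [IntermediateField.adjoin.finrank hintζ, ← Nat.totient_prime hq,
      ← Polynomial.natDegree_cyclotomic q GaussianField]
    exact Polynomial.natDegree_le_of_dvd (minpoly.dvd _ _ (by
      rw [Polynomial.aeval_def, Polynomial.eval₂_eq_eval_map, Polynomial.map_cyclotomic]
      exact hζ.isRoot_cyclotomic hq.pos)) (Polynomial.cyclotomic_ne_zero _ _)
  -- `M` contains the product of `i` and a primitive `q`-th root of unity; its order is `4q`, so its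
  -- degree over `ℚ` is `φ(4q) = 2(q - 1)`.
  have hge : 2 * (q - 1) ≤ 2 * Module.finrank GaussianField M := by
    have h2 := Module.finrank_mul_finrank ℚ GaussianField M
    rw [finrank_gaussianField] at h2
    rw [h2]
    have hI : orderOf (algebraMap GaussianField M
        ⟨Complex.I, IntermediateField.mem_adjoin_simple_self ℚ Complex.I⟩) = 4 := by
      have h1 := orderOf_injective (algebraMap GaussianField M : GaussianField →* M)
        (algebraMap GaussianField M).injective
        ⟨Complex.I, IntermediateField.mem_adjoin_simple_self ℚ Complex.I⟩
      have h2 := orderOf_injective (algebraMap GaussianField ℂ : GaussianField →* ℂ)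
        (algebraMap GaussianField ℂ).injective
        ⟨Complex.I, IntermediateField.mem_adjoin_simple_self ℚ Complex.I⟩
      exact h1.trans (h2.symm.trans isPrimitiveRoot_I.eq_orderOf.symm)
    have hcop : Nat.Coprime 4 q :=
      Nat.Coprime.pow_left 2 ((Nat.coprime_primes Nat.prime_two hq).2 hq2.ne)
    have hξ := IsPrimitiveRoot.orderOf (algebraMap GaussianField M
        ⟨Complex.I, IntermediateField.mem_adjoin_simple_self ℚ Complex.I⟩ *
          IsCyclotomicExtension.zeta q GaussianField M)
    rw [(Commute.all _ _).orderOf_mul_eq_mul_orderOf_of_coprime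
      (by rw [hI, ← hζM.eq_orderOf]; exact hcop), hI, ← hζM.eq_orderOf] at hξ
    have : FiniteDimensional ℚ M := Module.Finite.trans GaussianField M
    have hdeg := minpoly.natDegree_le (A := ℚ) (algebraMap GaussianField M
        ⟨Complex.I, IntermediateField.mem_adjoin_simple_self ℚ Complex.I⟩ *
          IsCyclotomicExtension.zeta q GaussianField M)
    rw [← Polynomial.cyclotomic_eq_minpoly_rat hξ (by have := hq.pos; omega),
      Polynomial.natDegree_cyclotomic, Nat.totient_mul hcop, Nat.totient_prime hq] at hdeg
    exact (show Nat.totient 4 = 2 by decide) ▸ hdeg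
  refine exists_cyclicExtension_of_dvd hn M ?_
  rw [show Module.finrank GaussianField M = q - 1 by omega]
  exact (Nat.modEq_iff_dvd' hq.one_lt.le).1 hqn.symm

/-! ### Totally split primes -/

/-- A nonconstant integer polynomial has a value divisible by a prime exceeding a given bound. -/
theorem exists_prime_dvd_eval (f : Polynomial ℤ) (hf : 0 < f.natDegree) (B : ℕ) :
    ∃ p : ℕ, p.Prime ∧ B < p ∧ ∃ m : ℤ, (p : ℤ) ∣ f.eval m := by
  by_cases h0 : f.eval 0 = 0
  · obtain ⟨p, hBp, hp⟩ := Nat.exists_infinite_primes (B + 1)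
    exact ⟨p, hp, hBp, 0, by rw [h0]; exact dvd_zero _⟩
  set c := f.eval 0
  -- the values at multiples of `c * B!` are `c * (1 + B! * _)`
  have hfin : {t : ℤ | f.eval t = c ∨ f.eval t = -c}.Finite := by
    have h1 : ∀ a : ℤ, {t : ℤ | f.eval t = a}.Finite := fun a => by
      have hne : f - Polynomial.C a ≠ 0 := fun h => by
        rw [sub_eq_zero.1 h, Polynomial.natDegree_C] at hf
        exact lt_irrefl _ hf
      refine ((f - Polynomial.C a).roots.toFinset.finite_toSet).subset fun t ht => ?_
      have ht' : f.eval t = a := ht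
      rw [Finset.mem_coe, Multiset.mem_toFinset, Polynomial.mem_roots hne, Polynomial.IsRoot,
        Polynomial.eval_sub, Polynomial.eval_C, ht', sub_self]
    exact (h1 c).union (h1 (-c))
  have hinj : Function.Injective fun t : ℤ => c * B.factorial * t :=
    mul_right_injective₀ (mul_ne_zero h0 (by exact_mod_cast B.factorial_ne_zero))
  -- Only finitely many `t` give the value `c` or `-c`; any other makes the cofactor `v` a non-unit,
  -- and `v ≡ 1` modulo `B!` has no prime factor up to `B`.
  obtain ⟨t, ht⟩ := (hfin.preimage hinj.injOn).infinite_compl.nonempty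
  have hdvd : c * B.factorial ∣ f.eval (c * B.factorial * t) - c := by
    have := f.sub_dvd_eval_sub (c * B.factorial * t) 0
    rw [sub_zero] at this
    exact (dvd_mul_right _ _).trans this
  obtain ⟨w, hw⟩ := hdvd
  have hval : f.eval (c * B.factorial * t) = c * (1 + B.factorial * w) := by linarith
  set v : ℤ := 1 + B.factorial * w
  have hv : v.natAbs ≠ 1 := fun h => by
    apply ht
    change f.eval _ = c ∨ f.eval _ = -c
    rw [hval]
    rcases Int.natAbs_eq v with h' | h' <;> rw [h] at h' <;> rw [h'] <;> simp
  obtain ⟨p, hp, hpv⟩ := Nat.exists_prime_and_dvd hv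
  have hpv' : (p : ℤ) ∣ v := Int.natCast_dvd.2 hpv
  refine ⟨p, hp, ?_, c * B.factorial * t, hval ▸ hpv'.mul_left c⟩
  by_contra hB
  have h1 : (p : ℤ) ∣ B.factorial * w :=
    (Int.natCast_dvd_natCast.2 (Nat.dvd_factorial hp.pos (not_lt.1 hB))).mul_right w
  have h2 : (p : ℤ) ∣ 1 := (dvd_add_left h1).1 hpv'
  exact hp.one_lt.ne' (by exact_mod_cast Int.eq_one_of_dvd_one (by positivity) h2)

/-- The discriminant of the power basis of `θ` is a nonzero integer that lies in the conductor of
`ℤ[θ]`. Hence the Kummer–Dedekind description holds for all large primes. -/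
theorem exponent_ne_zero {N : Type*} [Field N] [NumberField N] {θ : 𝓞 N}
    (h : Algebra.adjoin ℚ {(θ : N)} = ⊤) : RingOfIntegers.exponent θ ≠ 0 := by
  have hint : IsIntegral ℚ (θ : N) := (θ.isIntegral_coe).tower_top
  let pb := PowerBasis.ofAdjoinEqTop hint h
  have hgen : pb.gen = (θ : N) := PowerBasis.ofAdjoinEqTop_gen hint h
  have hgint : IsIntegral ℤ pb.gen := hgen ▸ θ.isIntegral_coe
  have hD : IsIntegral ℤ (Algebra.discr ℚ pb.basis) :=
    Algebra.discr_isIntegral ℚ fun i => by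
      rw [pb.basis_eq_pow]; exact hgint.pow _
  obtain ⟨d, hd⟩ := IsIntegrallyClosed.isIntegral_iff.1 hD
  have hd0 : d ≠ 0 := by
    rintro rfl
    exact Algebra.discr_not_zero_of_basis ℚ pb.basis (by rw [← hd]; simp)
  have hmem : (d : 𝓞 N) ∈ conductor ℤ θ := fun b => by
    have h1 := Algebra.discr_mul_isIntegral_mem_adjoin ℚ hgint b.isIntegral_coe
    rw [← hd, hgen] at h1
    have h2 : (algebraMap ℤ ℚ d • (b : N)) = algebraMap (𝓞 N) N (d * b) := by
      rw [Algebra.smul_def]; simp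
    rw [h2] at h1
    have h3 : Algebra.adjoin ℤ {(θ : N)} =
        (Algebra.adjoin ℤ {θ}).map (IsScalarTower.toAlgHom ℤ (𝓞 N) N) := by
      rw [AlgHom.map_adjoin, Set.image_singleton]; rfl
    rw [h3] at h1
    obtain ⟨c, hc, hcb⟩ := h1
    rwa [← RingOfIntegers.ext hcb]
  rw [RingOfIntegers.exponent_eq_sInf]
  have hne : {d : ℕ | 0 < d ∧ (d : 𝓞 N) ∈ conductor ℤ θ}.Nonempty := by
    refine ⟨d.natAbs, Int.natAbs_pos.2 hd0, ?_⟩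
    rcases Int.natAbs_eq d with h' | h' <;> rw [h'] at hmem
    · simpa using hmem
    · simpa using hmem
  exact (Nat.sInf_mem hne).1.ne'

theorem exists_integral_primitive_element (N : Type*) [Field N] [NumberField N] :
    ∃ θ : 𝓞 N, Algebra.adjoin ℚ {(θ : N)} = ⊤ := by
  obtain ⟨θ₀, hθ₀⟩ := Field.exists_primitive_element ℚ N
  obtain ⟨y, hy, hint⟩ :=
    ((IsFractionRing.isAlgebraic_iff ℤ ℚ N).2
      (Algebra.IsAlgebraic.isAlgebraic θ₀)).exists_integral_multiple
  refine ⟨⟨y • θ₀, hint⟩, ?_⟩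
  rw [← IntermediateField.top_toSubalgebra, ← hθ₀,
    IntermediateField.adjoin_simple_toSubalgebra_of_isAlgebraic (Algebra.IsAlgebraic.isAlgebraic _)]
  refine le_antisymm (Algebra.adjoin_le ?_) (Algebra.adjoin_le ?_) <;>
    rw [Set.singleton_subset_iff]
  · exact zsmul_mem (Algebra.self_mem_adjoin_singleton ℚ θ₀) y
  · have h1 := Subalgebra.smul_mem _ (Algebra.self_mem_adjoin_singleton ℚ (y • θ₀)) (y : ℚ)⁻¹
    rwa [← Int.cast_smul_eq_zsmul ℚ y θ₀, smul_smul, inv_mul_cancel₀ (by exact_mod_cast hy),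
      one_smul, Int.cast_smul_eq_zsmul] at h1

/-- A number field has degree one primes of arbitrarily large characteristic. -/
theorem exists_prime_ringHom_zmod (N : Type*) [Field N] [NumberField N] (B : ℕ) :
    ∃ p : ℕ, p.Prime ∧ B < p ∧ Nonempty (𝓞 N →+* ZMod p) := by
  obtain ⟨θ, hθ⟩ := exists_integral_primitive_element N
  obtain ⟨p, hp, hBp, m, hm⟩ := exists_prime_dvd_eval (minpoly ℤ θ)
    (minpoly.natDegree_pos θ.isIntegral) (max B (RingOfIntegers.exponent θ))
  have : Fact p.Prime := ⟨hp⟩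
  refine ⟨p, hp, (le_max_left _ _).trans_lt hBp, ⟨?_⟩⟩
  have hexp : ¬ p ∣ RingOfIntegers.exponent θ := fun h =>
    absurd (Nat.le_of_dvd (Nat.pos_of_ne_zero (exponent_ne_zero hθ)) h)
      (not_le.2 ((le_max_right _ _).trans_lt hBp))
  -- Kummer–Dedekind: `𝓞 N / p` is `𝔽_p[X]` modulo the reduced minimal polynomial, and evaluation at
  -- its root `m` is well defined on this quotient.
  refine (Ideal.Quotient.lift _ (Polynomial.evalRingHom (m : ZMod p)) ?_).comp
    ((RingOfIntegers.ZModXQuotSpanEquivQuotSpan hexp).symm.toRingHom.comp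
      (Ideal.Quotient.mk (Ideal.span {(p : 𝓞 N)})))
  intro a ha
  obtain ⟨b, rfl⟩ := Ideal.mem_span_singleton.1 ha
  rw [map_mul, Polynomial.coe_evalRingHom, Polynomial.eval_intCast_map]
  simp [(ZMod.intCast_zmod_eq_zero_iff_dvd _ _).2 hm]

/-- The embeddings of `K` in `ℂ`, composed with a prime of degree one of the normal closure, give
distinct homomorphisms to a prime field. -/
theorem exists_prime_injective_reduction (K : Type*) [Field K] [NumberField K] (B : ℕ) :
    ∃ p : ℕ, p.Prime ∧ B < p ∧ ∃ ψ : (K →ₐ[ℚ] ℂ) → (𝓞 K →+* ZMod p), Function.Injective ψ ∧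
      ∀ (g : K →ₐ[ℚ] K) (φ : K →ₐ[ℚ] ℂ),
        ψ (φ.comp g) = (ψ φ).comp (RingOfIntegers.mapRingHom (g : K →+* K)) := by
  classical
  let N : IntermediateField ℚ ℂ := IntermediateField.normalClosure ℚ K ℂ
  have : NumberField N := NumberField.of_module_finite ℚ N
  obtain ⟨θ, hθ⟩ := exists_integral_primitive_element K
  let r : (K →ₐ[ℚ] ℂ) → (𝓞 K →+* 𝓞 N) := fun φ => RingOfIntegers.mapRingHom
    ((φ.codRestrict N.toSubalgebra fun x => φ.fieldRange_le_normalClosure ⟨x, rfl⟩ :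
      K →ₐ[ℚ] N) : K →+* N)
  have hr : ∀ φ x, ((r φ x : N) : ℂ) = φ x := fun φ x => rfl
  -- A prime larger than the norm of `d` does not kill `d`, so the conjugates of `θ` stay distinct
  -- modulo it and already separate the reductions.
  let d : 𝓞 N := ∏ q ∈ (Finset.univ : Finset (K →ₐ[ℚ] ℂ)).offDiag, (r q.1 θ - r q.2 θ)
  have hd : d ≠ 0 := Finset.prod_ne_zero_iff.2 fun q hq h => (Finset.mem_offDiag.1 hq).2.2 <| by
    have h1 : q.1 θ = q.2 θ := by rw [← hr, ← hr, sub_eq_zero.1 h]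
    exact AlgHom.ext_of_adjoin_eq_top hθ (by simpa using h1)
  obtain ⟨p, hp, hBp, ⟨ψ⟩⟩ :=
    exists_prime_ringHom_zmod N (max B (Ideal.absNorm (Ideal.span {d})))
  have : Fact p.Prime := ⟨hp⟩
  have hψd : ψ d ≠ 0 := fun h0 => by
    obtain ⟨c, hc⟩ := Ideal.mem_span_singleton.1 (Ideal.absNorm_mem (Ideal.span {d}))
    have h1 : ((Ideal.absNorm (Ideal.span {d}) : ℕ) : ZMod p) = 0 := by
      rw [← map_natCast ψ, hc, map_mul, h0, zero_mul]
    rw [ZMod.natCast_eq_zero_iff] at h1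
    refine absurd (Nat.le_of_dvd (Nat.pos_of_ne_zero ?_) h1)
      (not_le.2 ((le_max_right _ _).trans_lt hBp))
    rwa [Ne, Ideal.absNorm_eq_zero_iff, Ideal.span_singleton_eq_bot]
  refine ⟨p, hp, (le_max_left _ _).trans_lt hBp, fun φ => ψ.comp (r φ), fun φ₁ φ₂ h => ?_,
    fun g φ => rfl⟩
  by_contra hne
  refine hψd ?_
  rw [map_prod]
  refine Finset.prod_eq_zero (i := (φ₁, φ₂)) (by simpa using hne) ?_
  rw [map_sub, sub_eq_zero]
  exact RingHom.congr_fun h θ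

/-- Every class modulo the kernel contains an integer, on which both maps agree. Thus distinct maps
to `𝔽_p` give distinct primes. -/
theorem RingHom.eq_of_ker_eq_zmod {R : Type*} [CommRing R] {p : ℕ} [NeZero p] {f g : R →+* ZMod p}
    (h : RingHom.ker f = RingHom.ker g) : f = g := by
  ext x
  have h1 : x - ((f x).val : R) ∈ RingHom.ker f := by simp [RingHom.mem_ker]
  rw [h, RingHom.mem_ker, map_sub, map_natCast, ZMod.natCast_zmod_val, sub_eq_zero] at h1
  exact h1.symm

theorem ker_mem_primesOver {R : Type*} [CommRing R] {p : ℕ} [Fact p.Prime] (f : R →+* ZMod p) :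
    RingHom.ker f ∈ Ideal.primesOver (Ideal.span {(p : ℤ)}) R := by
  refine ⟨RingHom.ker_isPrime f, ⟨?_⟩⟩
  rw [Ideal.under_def, RingHom.comap_ker, ← ZMod.ker_intCastRingHom]
  congr 1
  exact RingHom.ext_int _ _

theorem ncard_primesOver_le_finrank (K : Type*) [Field K] [NumberField K] (p : ℕ)
    [Fact p.Prime] :
    (Ideal.primesOver (Ideal.span {(p : ℤ)}) (𝓞 K)).ncard ≤ Module.finrank ℚ K := by
  have : (Ideal.span {(p : ℤ)}).IsMaximal := Int.ideal_span_isMaximal_of_prime p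
  have : Finite (Ideal.primesOver (Ideal.span {(p : ℤ)}) (𝓞 K)) :=
    IsDedekindDomain.primesOver_finite _ _
  have := Fintype.ofFinite (Ideal.primesOver (Ideal.span {(p : ℤ)}) (𝓞 K))
  rw [← RingOfIntegers.rank K,
    ← Ideal.sum_ramification_inertia_eq_finrank (S := 𝓞 K) (Ideal.span {(p : ℤ)}),
    ← Nat.card_coe_set_eq, Nat.card_eq_fintype_card, ← Finset.card_univ, Finset.card_eq_sum_ones]
  refine Finset.sum_le_sum fun P _ => ?_
  have := P.2.1
  exact Nat.mul_pos (P.1.ramificationIdx_pos ℤ) (P.1.inertiaDeg_pos ℤ)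

namespace CyclicExtension

variable {n : ℕ} (E : CyclicExtension n)

theorem finrank_rat : Module.finrank ℚ E.K = 2 * n := by
  rw [← Module.finrank_mul_finrank ℚ GaussianField E.K, finrank_gaussianField, E.finrank_eq]

theorem orderOf_gen : orderOf E.gen = n := by
  rw [orderOf_eq_card_of_forall_mem_zpowers E.gen_spec, IsGalois.card_aut_eq_finrank, E.finrank_eq]

theorem gen_pow_injective : Function.Injective fun i : Fin n => E.gen ^ (i : ℕ) := fun i j h => by
  rw [pow_inj_mod, E.orderOf_gen, Nat.mod_eq_of_lt i.2, Nat.mod_eq_of_lt j.2] at h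
  exact Fin.ext h

/-- There are arbitrarily large primes that split in `K`; the reductions of the relative embeddings
modulo a prime above are distinct. -/
theorem exists_splits (B : ℕ) : ∃ p : ℕ, p.Prime ∧ B < p ∧ E.Splits p ∧
    ∃ ψ : 𝓞 E.K →+* ZMod p, Function.Injective fun i : Fin n => ψ.comp (E.relEmb i) := by
  obtain ⟨p, hp, hBp, ψ, hψ, hcomp⟩ := exists_prime_injective_reduction E.K B
  have : Fact p.Prime := ⟨hp⟩
  refine ⟨p, hp, hBp, le_antisymm ?_ ?_, ψ (E.K.val.restrictScalars ℚ), fun i j hij => ?_⟩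
  · rw [← E.finrank_rat]
    exact ncard_primesOver_le_finrank E.K p
  · have hfin : (Ideal.primesOver (Ideal.span {(p : ℤ)}) (𝓞 E.K)).Finite := by
      have : (Ideal.span {(p : ℤ)}).IsMaximal := Int.ideal_span_isMaximal_of_prime p
      exact IsDedekindDomain.primesOver_finite _ _
    -- The `2n` complex embeddings yield `2n` distinct kernels above `p`, the largest possible
    -- number.
    rw [← E.finrank_rat, ← AlgHom.card ℚ E.K ℂ, ← Nat.card_eq_fintype_card, ← Set.ncard_univ]
    exact Set.ncard_le_ncard_of_injOn (fun φ => RingHom.ker (ψ φ))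
      (fun φ _ => ker_mem_primesOver _)
      (fun φ _ φ' _ h => hψ (RingHom.eq_of_ker_eq_zmod h)) hfin
  · have h1 : ∀ i : ℕ, (ψ (E.K.val.restrictScalars ℚ)).comp (E.relEmb i) =
        ψ ((E.K.val.restrictScalars ℚ).comp
          (((E.gen ^ i : E.K ≃ₐ[GaussianField] E.K) : E.K →ₐ[GaussianField] E.K).restrictScalars
            ℚ)) := fun i => by rw [hcomp]; rfl
    simp only [h1] at hij
    have h2 := hψ hij
    have h3 : E.gen ^ (i : ℕ) = E.gen ^ (j : ℕ) := by
      ext x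
      exact congrArg (fun f : E.K →ₐ[ℚ] ℂ => f x) h2
    exact E.gen_pow_injective h3

end CyclicExtension

/-! ### The canonical embedding and the reduction -/

/-- The vectors of values of distinct characters span. -/
theorem span_range_monoidHom_eq_top {ι R F : Type*} [Fintype ι] [Monoid R] [Field F]
    (f : ι → R →* F) (hf : Function.Injective f) :
    Submodule.span F (Set.range fun (x : R) (i : ι) => f i x) = ⊤ := by
  classical
  by_contra hne
  -- A nonzero functional that vanishes on the span would be a linear relation between distinct
  -- characters, against Dedekind's independence theorem.
  obtain ⟨g, hg0, hg⟩ := Submodule.exists_le_ker_of_lt_top _ (lt_top_iff_ne_top.2 hne)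
  have hli := (linearIndependent_monoidHom R F).comp f hf
  rw [Fintype.linearIndependent_iff] at hli
  have hzero := hli (fun i => g (Pi.single i 1)) (by
    ext x
    have h1 : g (fun i => f i x) = 0 := hg (Submodule.subset_span ⟨x, rfl⟩)
    rw [LinearMap.pi_apply_eq_sum_univ g] at h1
    simp only [Finset.sum_apply, Pi.smul_apply, smul_eq_mul, Function.comp, Pi.zero_apply]
    rw [← h1]
    refine Finset.sum_congr rfl fun i _ => ?_
    rw [smul_eq_mul, mul_comm]
    congr 2
    ext j
    simp [Pi.single_apply, eq_comm])
  refine hg0 (LinearMap.ext fun v => ?_)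
  rw [LinearMap.pi_apply_eq_sum_univ g, LinearMap.zero_apply]
  refine Finset.sum_eq_zero fun i _ => ?_
  have : (fun j => if i = j then (1 : F) else 0) = Pi.single i 1 := by
    ext j; simp [Pi.single_apply, eq_comm]
  rw [this, hzero i, smul_zero]

/-- Independence of characters plays the role of the Chinese remainder theorem: the range spans, and
over the prime field an additive subgroup is already a subspace. -/
theorem pi_ringHom_zmod_surjective {ι R : Type*} [Fintype ι] [CommRing R] {p : ℕ} [Fact p.Prime]
    (f : ι → R →+* ZMod p) (hf : Function.Injective f) :
    Function.Surjective (RingHom.pi f) := by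
  have h1 := span_range_monoidHom_eq_top (fun i => (f i : R →* ZMod p)) fun i j h =>
    hf (RingHom.ext fun x => DFunLike.congr_fun h x)
  let S : Submodule (ZMod p) (ι → ZMod p) :=
    AddSubgroup.toZModSubmodule p (RingHom.pi f).toAddMonoidHom.range
  have h2 : Submodule.span (ZMod p) (Set.range fun (x : R) (i : ι) => (f i : R →* ZMod p) x) ≤ S :=
    Submodule.span_le.2 (by rintro _ ⟨x, rfl⟩; exact ⟨x, rfl⟩)
  intro v
  have h3 : v ∈ S := h2 (h1 ▸ Submodule.mem_top)
  exact h3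

namespace CyclicExtension

variable {n : ℕ} (E : CyclicExtension n)

theorem canonicalEmb_apply (x : 𝓞 E.K) (i : Fin n) :
    E.canonicalEmb x i = ((E.gen ^ (i : ℕ)) (x : E.K) : ℂ) := rfl

theorem canonicalEmb_injective (hn : 0 < n) : Function.Injective E.canonicalEmb := fun x y h => by
  have h1 := congrFun h ⟨0, hn⟩
  rw [canonicalEmb_apply, canonicalEmb_apply] at h1
  simp only [pow_zero, AlgEquiv.one_apply] at h1
  exact RingOfIntegers.ext (Subtype.ext h1)

theorem exists_gen_pow_eq (hn : 0 < n) (φ : E.K →ₐ[GaussianField] ℂ) :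
    ∃ i : Fin n, ∀ x, φ x = ((E.gen ^ (i : ℕ)) x : ℂ) := by
  have h1 := (Normal.algHomEquivAut GaussianField ℂ E.K).symm_apply_apply φ
  obtain ⟨i, hi⟩ := mem_powers_iff_mem_zpowers.2
    (E.gen_spec (Normal.algHomEquivAut GaussianField ℂ E.K φ))
  have hi' : E.gen ^ (i % n) = Normal.algHomEquivAut GaussianField ℂ E.K φ := by
    rw [← hi]
    have h2 := pow_mod_orderOf E.gen i
    rwa [E.orderOf_gen] at h2
  refine ⟨⟨i % n, Nat.mod_lt _ hn⟩, fun x => ?_⟩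
  rw [← h1, hi']
  rfl

/-- Up to complex conjugation, every complex embedding of `K` is a relative embedding. -/
theorem exists_norm_eq (hn : 0 < n) (φ : E.K →ₐ[ℚ] ℂ) :
    ∃ i : Fin n, ∀ x : 𝓞 E.K, ‖φ x‖ = ‖E.canonicalEmb x i‖ := by
  -- An embedding that fixes `i` is `ℚ(i)`-linear, hence a power of the generator; one that sends
  -- `i` to `-i` is first composed with conjugation.
  have key : ∀ φ : E.K →ₐ[ℚ] ℂ, φ (algebraMap GaussianField E.K
      (IntermediateField.AdjoinSimple.gen ℚ Complex.I)) = Complex.I →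
      ∃ i : Fin n, ∀ x : 𝓞 E.K, φ x = E.canonicalEmb x i := fun φ hφ => by
    have h1 : φ.comp ((Algebra.ofId GaussianField E.K).restrictScalars ℚ) = GaussianField.val :=
      IntermediateField.algHom_ext_of_eq_adjoin _ rfl (by
        rintro x (rfl : x = Complex.I)
        exact hφ)
    let φ' : E.K →ₐ[GaussianField] ℂ :=
      { (φ : E.K →+* ℂ) with commutes' := fun r => DFunLike.congr_fun h1 r }
    obtain ⟨i, hi⟩ := E.exists_gen_pow_eq hn φ'
    exact ⟨i, fun x => hi x⟩
  have hsq : φ (algebraMap GaussianField E.K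
      (IntermediateField.AdjoinSimple.gen ℚ Complex.I)) ^ 2 = Complex.I ^ 2 := by
    have h1 : (IntermediateField.AdjoinSimple.gen ℚ Complex.I) ^ 2 = -1 :=
      Subtype.ext (by simp)
    rw [← map_pow, ← map_pow, h1]; simp
  rcases sq_eq_sq_iff_eq_or_eq_neg.1 hsq with h | h
  · obtain ⟨i, hi⟩ := key φ h
    exact ⟨i, fun x => by rw [hi]⟩
  · obtain ⟨i, hi⟩ := key (((Complex.conjAe : ℂ →ₐ[ℝ] ℂ).restrictScalars ℚ).comp φ) (by
      rw [AlgHom.comp_apply, h]; simp)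
    refine ⟨i, fun x => ?_⟩
    rw [← hi, AlgHom.comp_apply]
    exact (Complex.norm_conj _).symm

theorem norm_le_of_canonicalEmb_le (hn : 0 < n) {x : 𝓞 E.K} {B : ℝ}
    (h : ∀ i, ‖E.canonicalEmb x i‖ ≤ B) (φ : E.K →+* ℂ) : ‖φ x‖ ≤ B := by
  obtain ⟨i, hi⟩ := E.exists_norm_eq hn φ.toRatAlgHom
  exact (hi x).trans_le (h i)

/-- A nonzero integer that reduces to `0` modulo the `n` primes has a large conjugate. -/
theorem pow_le_of_reduction_eq_zero (hn : 0 < n) {p : ℕ} [Fact p.Prime] (ψ : 𝓞 E.K →+* ZMod p)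
    (hψ : Function.Injective fun i : Fin n => ψ.comp (E.relEmb i)) {x : 𝓞 E.K} (hx : x ≠ 0)
    (h0 : ∀ i : Fin n, ψ (E.relEmb i x) = 0) {B : ℝ} (hB : ∀ i, ‖E.canonicalEmb x i‖ ≤ B) :
    (p : ℝ) ^ n ≤ B ^ (2 * n) := by
  have hsurj := pi_ringHom_zmod_surjective _ hψ
  set ρ := RingHom.pi fun i : Fin n => ψ.comp (E.relEmb i)
  -- Since `ρ` is onto, its kernel has index `pⁿ`, which divides the norm of `x`; that norm is a
  -- product of `2n` embeddings of size at most `B`.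
  have hcard : Ideal.absNorm (RingHom.ker ρ) = p ^ n := by
    rw [Ideal.absNorm_apply, Submodule.cardQuot_apply,
      Nat.card_congr (RingHom.quotientKerEquivOfSurjective hsurj).toEquiv]
    simp
  have hmem : x ∈ RingHom.ker ρ := funext h0
  have hdvd := Ideal.absNorm_dvd_norm_of_mem hmem
  rw [hcard] at hdvd
  have hnorm0 : Algebra.norm ℤ x ≠ 0 := Algebra.norm_ne_zero_iff.2 hx
  have h1 : (p : ℝ) ^ n ≤ |(Algebra.norm ℤ x : ℝ)| := by
    have := Int.le_of_dvd (abs_pos.2 hnorm0) ((dvd_abs _ _).2 hdvd)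
    exact_mod_cast this
  have h2 : ((Algebra.norm ℤ x : ℤ) : ℂ) = ∏ φ : E.K →ₐ[ℚ] ℂ, φ x := by
    rw [← Algebra.norm_eq_prod_embeddings ℚ ℂ (x : E.K), ← Algebra.coe_norm_int]
    simp
  have h3 : |(Algebra.norm ℤ x : ℝ)| ≤ ∏ φ : E.K →ₐ[ℚ] ℂ, B := by
    rw [← Complex.norm_intCast, h2, norm_prod]
    exact Finset.prod_le_prod (fun _ _ => norm_nonneg _) fun φ _ =>
      E.norm_le_of_canonicalEmb_le hn hB φ
  rw [Finset.prod_const, Finset.card_univ, AlgHom.card, E.finrank_rat] at h3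
  exact h1.trans h3

/-- The image of the ring of integers under the canonical embedding. -/
noncomputable def integerLattice : Submodule ℤ (Fin n → ℂ) :=
  AddSubgroup.toIntSubmodule E.canonicalEmb.toAddMonoidHom.range

/-- The relative embeddings fix `i`, so multiplication by `i ∈ 𝓞 K` acts on the image as the scalar
`i`. The real span is therefore a complex subspace, and it is everything by independence of
characters. -/
theorem span_integerLattice : Submodule.span ℝ (E.integerLattice : Set (Fin n → ℂ)) = ⊤ := by
  set S := Submodule.span ℝ (E.integerLattice : Set (Fin n → ℂ)) with hS
  let ι : 𝓞 E.K := ⟨algebraMap GaussianField E.K (IntermediateField.AdjoinSimple.gen ℚ Complex.I),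
    IsIntegral.of_pow (n := 4) (by norm_num) (by
      rw [← map_pow, show (IntermediateField.AdjoinSimple.gen ℚ Complex.I) ^ 4 = 1 from
        Subtype.ext (by simp), map_one]
      exact isIntegral_one)⟩
  have hι : E.canonicalEmb ι = fun _ => Complex.I := by
    ext i
    rw [canonicalEmb_apply]
    exact congrArg (fun y : E.K => (y : ℂ)) (AlgEquiv.commutes _ _)
  have hI : ∀ v ∈ S, Complex.I • v ∈ S := fun v hv => by
    induction hv using Submodule.span_induction with
    | mem v hv =>
      obtain ⟨x, rfl⟩ := hv
      refine Submodule.subset_span ⟨ι * x, ?_⟩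
      refine (map_mul E.canonicalEmb ι x).trans ?_
      rw [hι]
      rfl
    | zero => rw [smul_zero]; exact S.zero_mem
    | add v w _ _ hv hw => rw [smul_add]; exact S.add_mem hv hw
    | smul c v _ hv => rw [smul_comm]; exact S.smul_mem c hv
  have hC : ∀ (c : ℂ), ∀ v ∈ S, c • v ∈ S := fun c v hv => by
    have h1 : c • v = c.re • v + c.im • Complex.I • v := by
      ext i
      simp only [Pi.add_apply, Pi.smul_apply, Complex.real_smul, smul_eq_mul]
      rw [← mul_assoc, ← add_mul, Complex.re_add_im]
    rw [h1]
    exact S.add_mem (S.smul_mem _ hv) (S.smul_mem _ (hI v hv))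
  have hspan := span_range_monoidHom_eq_top (F := ℂ) (R := 𝓞 E.K) (fun i : Fin n =>
    (((algebraMap E.K ℂ).comp ((algebraMap (𝓞 E.K) E.K).comp (E.relEmb i)) : 𝓞 E.K →+* ℂ) :
      𝓞 E.K →* ℂ)) fun i j hij => by
    obtain ⟨θ, hθ⟩ := exists_integral_primitive_element E.K
    have h1 : (E.gen ^ (i : ℕ)) (θ : E.K) = (E.gen ^ (j : ℕ)) (θ : E.K) :=
      Subtype.ext (DFunLike.congr_fun hij θ)
    have h2 : ((E.gen ^ (i : ℕ) : E.K ≃ₐ[GaussianField] E.K) :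
          E.K →ₐ[GaussianField] E.K).restrictScalars ℚ =
        ((E.gen ^ (j : ℕ) : E.K ≃ₐ[GaussianField] E.K) :
          E.K →ₐ[GaussianField] E.K).restrictScalars ℚ :=
      AlgHom.ext_of_adjoin_eq_top hθ (by rintro x (rfl : x = _); exact h1)
    exact E.gen_pow_injective (AlgEquiv.ext fun x => DFunLike.congr_fun h2 x)
  refine eq_top_iff.2 fun v _ => ?_
  have hv : v ∈ Submodule.span ℂ _ := hspan ▸ Submodule.mem_top
  induction hv using Submodule.span_induction with
  | mem v hv => exact Submodule.subset_span hv
  | zero => exact S.zero_mem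
  | add v w _ _ hv hw => exact S.add_mem (hv trivial) (hw trivial)
  | smul c v _ hv => exact hC c v (hv trivial)

/-- Bounded coordinates bound all conjugates, and only finitely many algebraic integers of `K` have
bounded conjugates. -/
theorem integerLattice_inter_closedBall_finite (hn : 0 < n) (r : ℝ) :
    ((E.integerLattice : Set (Fin n → ℂ)) ∩ Metric.closedBall 0 r).Finite := by
  refine ((Embeddings.finite_of_norm_le E.K ℂ r).preimage
    RingOfIntegers.coe_injective.injOn |>.image E.canonicalEmb).subset ?_
  rintro _ ⟨⟨x, rfl⟩, hx⟩
  refine ⟨x, ⟨x.isIntegral_coe, fun φ => E.norm_le_of_canonicalEmb_le hn (fun i => ?_) φ⟩, rfl⟩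
  exact (norm_le_pi_norm _ i).trans (mem_closedBall_zero_iff.1 hx)

end CyclicExtension

/-! ### Lattices: discreteness, covolume, packing -/

section Lattice

variable {V : Type*} [NormedAddCommGroup V]

theorem discreteTopology_of_inter_closedBall_finite (L : Submodule ℤ V)
    (h : ((L : Set V) ∩ Metric.closedBall 0 1).Finite) : DiscreteTopology L := by
  refine discreteTopology_of_isOpen_singleton_zero ?_
  refine isOpen_singleton_of_finite_mem_nhds 0 (s := Metric.closedBall 0 1)
    (Metric.closedBall_mem_nhds _ zero_lt_one) ?_
  refine Set.Finite.of_finite_image (f := Subtype.val) (h.subset ?_) Subtype.val_injective.injOn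
  rintro _ ⟨x, hx, rfl⟩
  exact ⟨x.2, by simpa using hx⟩

variable [NormedSpace ℝ V]

theorem smul_inter_closedBall_finite {L : Submodule ℤ V} {a : ℝ} (ha : 0 < a)
    (h : ∀ r, ((L : Set V) ∩ Metric.closedBall 0 r).Finite) (r : ℝ) :
    (((a • L : Submodule ℤ V) : Set V) ∩ Metric.closedBall 0 r).Finite := by
  refine ((h (a⁻¹ * r)).image fun x => a • x).subset ?_
  rintro _ ⟨⟨x, hx, rfl⟩, hr⟩
  refine ⟨x, ⟨hx, ?_⟩, rfl⟩
  rw [mem_closedBall_zero_iff] at hr ⊢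
  change ‖a • x‖ ≤ r at hr
  rw [norm_smul, Real.norm_of_nonneg ha.le] at hr
  rw [inv_mul_eq_div, le_div_iff₀ ha, mul_comm]
  exact hr

theorem span_smul_eq_top {L : Submodule ℤ V} {a : ℝ} (ha : 0 < a)
    (h : Submodule.span ℝ (L : Set V) = ⊤) :
    Submodule.span ℝ ((a • L : Submodule ℤ V) : Set V) = ⊤ := by
  refine eq_top_iff.2 (h ▸ Submodule.span_le.2 fun x hx => ?_)
  have h1 : a • x ∈ Submodule.span ℝ ((a • L : Submodule ℤ V) : Set V) :=
    Submodule.subset_span (Submodule.smul_mem_pointwise_smul x a L hx)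
  simpa [smul_smul, inv_mul_cancel₀ ha.ne'] using Submodule.smul_mem _ a⁻¹ h1

variable [FiniteDimensional ℝ V] [MeasurableSpace V] [BorelSpace V] (μ : Measure V)
  [μ.IsAddHaarMeasure]

/-- The index of a sublattice is the ratio of the covolumes. -/
theorem covolume_eq_relIndex_mul (L₁ L₂ : Submodule ℤ V) [DiscreteTopology L₁] [IsZLattice ℝ L₁]
    [DiscreteTopology L₂] [IsZLattice ℝ L₂] (h : L₁ ≤ L₂) :
    ZLattice.covolume L₁ μ =
      L₁.toAddSubgroup.relIndex L₂.toAddSubgroup * ZLattice.covolume L₂ μ := by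
  classical
  have := ZLattice.module_free ℝ L₁
  have := ZLattice.module_finite ℝ L₁
  have := ZLattice.module_free ℝ L₂
  have := ZLattice.module_finite ℝ L₂
  let b₁ := Module.finBasisOfFinrankEq ℤ L₁ (ZLattice.rank ℝ L₁)
  let b₂ := Module.finBasisOfFinrankEq ℤ L₂ (ZLattice.rank ℝ L₂)
  have h₂ : ZLattice.covolume L₂ μ =
      μ.real (ZSpan.fundamentalDomain (b₂.ofZLatticeBasis ℝ L₂)) :=
    ZLattice.covolume_eq_measure_fundamentalDomain L₂ μ (ZLattice.isAddFundamentalDomain b₂ μ)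
  rw [AddSubgroup.relIndex_eq_natAbs_det L₁.toAddSubgroup L₂.toAddSubgroup h b₁ b₂,
    Nat.cast_natAbs, Int.cast_abs, h₂,
    ZLattice.covolume_eq_det_mul_measureReal L₁ μ b₁ (b₂.ofZLatticeBasis ℝ L₂)]
  congr 2
  change (b₂.ofZLatticeBasis ℝ L₂).det ((↑) ∘ b₁) =
    ((b₂.toMatrix (fun i => (⟨b₁ i, h (b₁ i).2⟩ : L₂))).det : ℝ)
  rw [Module.Basis.det_apply, Int.cast_det]
  congr 1
  ext i j
  rw [Matrix.map_apply, Module.Basis.toMatrix_apply, Module.Basis.toMatrix_apply]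
  exact b₂.ofZLatticeBasis_repr_apply ℝ L₂ ⟨b₁ j, h (b₁ j).2⟩ i

theorem covolume_smul (L : Submodule ℤ V) [DiscreteTopology L] [IsZLattice ℝ L] {a : ℝ}
    (ha : 0 < a) [DiscreteTopology (a • L : Submodule ℤ V)] [IsZLattice ℝ (a • L : Submodule ℤ V)] :
    ZLattice.covolume (a • L : Submodule ℤ V) μ =
      a ^ Module.finrank ℝ V * ZLattice.covolume L μ := by
  classical
  have := ZLattice.module_free ℝ L
  have := ZLattice.module_finite ℝ L
  let b := Module.finBasisOfFinrankEq ℤ L (ZLattice.rank ℝ L)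
  let e : L ≃ₗ[ℤ] (a • L : Submodule ℤ V) :=
    Submodule.equivMapOfInjective _ (smul_right_injective V ha.ne') L
  have he : ∀ x : L, ((e x : (a • L : Submodule ℤ V)) : V) = a • (x : V) := fun x => rfl
  let b₀ := b.ofZLatticeBasis ℝ L
  rw [ZLattice.covolume_eq_det_mul_measureReal L μ b b₀,
    ZLattice.covolume_eq_det_mul_measureReal _ μ (b.map e) b₀, ← mul_assoc]
  congr 1
  have h1 : ((↑) ∘ (b.map e) : Fin (Module.finrank ℝ V) → V) =
      fun i => a • ((↑) ∘ b : Fin (Module.finrank ℝ V) → V) i := by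
    ext i
    exact he _
  rw [h1, (b₀.det).map_smul_univ (fun _ => a), Finset.prod_const, Finset.card_univ,
    Fintype.card_fin, smul_eq_mul, abs_mul, abs_of_pos (pow_pos ha _)]

/-- The translates of a fundamental domain by scaled lattice points are disjoint. -/
theorem exists_packing_bound (L : Submodule ℤ V) [DiscreteTopology L] [IsZLattice ℝ L] :
    ∃ D : ℝ, 0 < D ∧ ∀ (a : ℝ), 0 < a → ∀ (T : Finset V), (T : Set V) ⊆ L → ∀ A : Set V,
      (∀ x ∈ T, ∀ w : V, ‖w‖ ≤ D → a • (x + w) ∈ A) →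
      T.card * ENNReal.ofReal (a ^ Module.finrank ℝ V * ZLattice.covolume L μ) ≤ μ A := by
  have := ZLattice.module_free ℝ L
  have := ZLattice.module_finite ℝ L
  let b := Module.finBasisOfFinrankEq ℤ L (ZLattice.rank ℝ L)
  let F := ZSpan.fundamentalDomain (b.ofZLatticeBasis ℝ L)
  have hF : IsAddFundamentalDomain L F μ := ZLattice.isAddFundamentalDomain b μ
  have hFm : MeasurableSet F := ZSpan.fundamentalDomain_measurableSet _
  have hFb : Bornology.IsBounded F := ZSpan.fundamentalDomain_isBounded _
  obtain ⟨D, hD0, hD⟩ := hFb.exists_pos_norm_le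
  refine ⟨D, hD0, fun a ha T hT A hA => ?_⟩
  have hvol : ∀ x : V, μ (a • (x +ᵥ F)) =
      ENNReal.ofReal (a ^ Module.finrank ℝ V * ZLattice.covolume L μ) := fun x => by
    rw [Measure.addHaar_smul_of_nonneg μ ha.le, measure_vadd,
      ZLattice.covolume_eq_measure_fundamentalDomain L μ hF,
      ENNReal.ofReal_mul (pow_nonneg ha.le _), ofReal_measureReal hFb.measure_lt_top.ne]
  have hdisj : (T : Set V).PairwiseDisjoint fun x => a • (x +ᵥ F) := by
    intro x hx y hy hxy
    refine Set.disjoint_left.2 ?_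
    rintro _ ⟨_, ⟨f, hf, rfl⟩, rfl⟩ ⟨_, ⟨f', hf', rfl⟩, h⟩
    have h1 : y + f' = x + f := smul_right_injective V ha.ne' h
    obtain ⟨v, -, hv⟩ := ZSpan.exist_unique_vadd_mem_fundamentalDomain (b.ofZLatticeBasis ℝ L) f
    have hL : Submodule.span ℤ (Set.range (b.ofZLatticeBasis ℝ L)) = L :=
      b.ofZLatticeBasis_span ℝ L
    -- Both `f` and its translate `f'` by `x - y` lie in the fundamental domain, so uniqueness of
    -- the translation forces `x = y`.
    have h2 := hv 0 (by change (0 : V) + f ∈ F; rwa [zero_add])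
    have h3 := hv ⟨x - y, hL.symm ▸ L.sub_mem (hT hx) (hT hy)⟩ (by
      change x - y + f ∈ F
      rwa [show x - y + f = f' by rw [sub_add_eq_add_sub, ← h1]; abel])
    have h4 : x - y = 0 := congrArg Subtype.val (h3.trans h2.symm)
    exact hxy (sub_eq_zero.1 h4)
  calc T.card * ENNReal.ofReal (a ^ Module.finrank ℝ V * ZLattice.covolume L μ)
      = ∑ x ∈ T, μ (a • (x +ᵥ F)) := by simp [hvol]
    _ = μ (⋃ x ∈ T, a • (x +ᵥ F)) := (measure_biUnion_finset hdisj fun x _ =>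
        (hFm.const_vadd x).const_smul_of_ne_zero ha.ne').symm
    _ ≤ μ A := measure_mono (Set.iUnion₂_subset fun x hx => by
        rintro _ ⟨_, ⟨f, hf, rfl⟩, rfl⟩
        exact hA x hx f (hD f hf))

end Lattice

/-! ### Construction A lattices -/

namespace CyclicExtension

variable {n : ℕ} (E : CyclicExtension n)

/-- The residues `(ψ x, ψ (gen x), …, ψ (gen^(n-1) x))`. -/
noncomputable def residues {p : ℕ} (ψ : 𝓞 E.K →+* ZMod p) : 𝓞 E.K →+* (Fin n → ZMod p) :=
  RingHom.pi fun i => ψ.comp (E.relEmb i)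

/-- The Construction A lattice attached to the kernel of a homomorphism to a prime field. -/
noncomputable def codeLattice {p : ℕ} (ψ : 𝓞 E.K →+* ZMod p) (C : Submodule (ZMod p) (Fin n → ZMod p)) :
    Submodule ℤ (Fin n → ℂ) :=
  E.constructionA (RingHom.ker ψ)
    (RingHom.quotientKerEquivOfSurjective (ZMod.ringHom_surjective ψ)) C

theorem codeLattice_eq {p : ℕ} (ψ : 𝓞 E.K →+* ZMod p) (C : Submodule (ZMod p) (Fin n → ZMod p)) :
    E.codeLattice ψ C = AddSubgroup.toIntSubmodule ((C.toAddSubgroup.comap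
      (E.residues ψ).toAddMonoidHom).map E.canonicalEmb.toAddMonoidHom) := rfl

theorem mem_codeLattice {p : ℕ} (ψ : 𝓞 E.K →+* ZMod p) (C : Submodule (ZMod p) (Fin n → ZMod p))
    {v : Fin n → ℂ} :
    v ∈ E.codeLattice ψ C ↔ ∃ x, E.residues ψ x ∈ C ∧ E.canonicalEmb x = v := Iff.rfl

theorem codeLattice_le {p : ℕ} (ψ : 𝓞 E.K →+* ZMod p) (C : Submodule (ZMod p) (Fin n → ZMod p)) :
    E.codeLattice ψ C ≤ E.integerLattice := by
  rintro v ⟨x, -, rfl⟩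
  exact ⟨x, rfl⟩

theorem isFullLattice_integerLattice (hn : 0 < n) : IsFullLattice E.integerLattice :=
  ⟨discreteTopology_of_inter_closedBall_finite _ (E.integerLattice_inter_closedBall_finite hn 1),
    E.span_integerLattice⟩

/-- The code lattice lies between `p` times the integer lattice, which gives the span, and the
integer lattice, which gives discreteness. -/
theorem isFullLattice_smul_codeLattice (hn : 0 < n) {p : ℕ} [Fact p.Prime] (ψ : 𝓞 E.K →+* ZMod p)
    (C : Submodule (ZMod p) (Fin n → ZMod p)) {a : ℝ} (ha : 0 < a) :
    IsFullLattice (a • E.codeLattice ψ C) := by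
  refine ⟨discreteTopology_of_inter_closedBall_finite _ ?_, span_smul_eq_top ha ?_⟩
  · exact (smul_inter_closedBall_finite ha (E.integerLattice_inter_closedBall_finite hn) 1).subset
      (Set.inter_subset_inter_left _ (Submodule.map_mono (E.codeLattice_le ψ C)))
  · have hp : (0 : ℝ) < p := by exact_mod_cast (Fact.out : p.Prime).pos
    rw [← top_le_iff, ← span_smul_eq_top hp E.span_integerLattice]
    refine Submodule.span_mono ?_
    rintro _ ⟨_, ⟨x, rfl⟩, rfl⟩
    refine (E.mem_codeLattice ψ C).2 ⟨p * x, ?_, ?_⟩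
    · rw [map_mul, map_natCast, show ((p : ℕ) : Fin n → ZMod p) = 0 by ext i; simp, zero_mul]
      exact C.zero_mem
    · rw [map_mul, map_natCast]
      ext i
      simp

theorem relIndex_codeLattice (hn : 0 < n) {p : ℕ} [Fact p.Prime] (ψ : 𝓞 E.K →+* ZMod p)
    (hψ : Function.Injective fun i : Fin n => ψ.comp (E.relEmb i))
    (C : Submodule (ZMod p) (Fin n → ZMod p)) :
    (E.codeLattice ψ C).toAddSubgroup.relIndex E.integerLattice.toAddSubgroup =
      p ^ (n - Module.finrank (ZMod p) C) := by
  have h1 : E.integerLattice.toAddSubgroup =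
      (⊤ : AddSubgroup (𝓞 E.K)).map E.canonicalEmb.toAddMonoidHom := AddMonoidHom.range_eq_map _
  have hsurj : Function.Surjective (E.residues ψ) := pi_ringHom_zmod_surjective _ hψ
  rw [h1, codeLattice_eq, AddSubgroup.toIntSubmodule_toAddSubgroup,
    AddSubgroup.relIndex_map_map_of_injective _ _ (E.canonicalEmb_injective hn),
    AddSubgroup.relIndex_top_right, AddSubgroup.index_comap_of_surjective _ hsurj]
  have h2 := Module.natCard_eq_pow_finrank (K := ZMod p) (V := (Fin n → ZMod p) ⧸ C)
  have h3 := Submodule.finrank_quotient_add_finrank C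
  rw [Module.finrank_fin_fun] at h3
  rw [Nat.card_zmod, show Module.finrank (ZMod p) ((Fin n → ZMod p) ⧸ C) =
    n - Module.finrank (ZMod p) C by omega] at h2
  exact h2

theorem covolume_smul_codeLattice (hn : 0 < n) {p : ℕ} [Fact p.Prime] (ψ : 𝓞 E.K →+* ZMod p)
    (hψ : Function.Injective fun i : Fin n => ψ.comp (E.relEmb i))
    (C : Submodule (ZMod p) (Fin n → ZMod p)) {a : ℝ} (ha : 0 < a) :
    ZLattice.covolume (a • E.codeLattice ψ C) = a ^ (2 * n) *
      (p ^ (n - Module.finrank (ZMod p) C) * ZLattice.covolume E.integerLattice) := by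
  have hM := E.isFullLattice_integerLattice hn
  have := hM.1
  have : IsZLattice ℝ E.integerLattice := ⟨hM.2⟩
  have h1 := E.isFullLattice_smul_codeLattice hn ψ C one_pos
  rw [one_smul] at h1
  have := h1.1
  have : IsZLattice ℝ (E.codeLattice ψ C) := ⟨h1.2⟩
  have h2 := E.isFullLattice_smul_codeLattice hn ψ C ha
  have := h2.1
  have : IsZLattice ℝ (a • E.codeLattice ψ C : Submodule ℤ (Fin n → ℂ)) := ⟨h2.2⟩
  rw [covolume_smul volume _ ha, covolume_eq_relIndex_mul volume _ _ (E.codeLattice_le ψ C),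
    E.relIndex_codeLattice hn ψ hψ]
  congr 2
  · simp [Module.finrank_pi_fintype, Complex.finrank_real_complex, mul_comm]
  · push_cast; rfl

end CyclicExtension

/-! ### Exponential estimates for the noise and for volumes -/

/-- Markov's inequality for a product of functions of independent variables. -/
theorem pi_measure_le_prod_integral {ι : Type*} [Fintype ι] {X : ι → Type*}
    [∀ i, MeasurableSpace (X i)] {μ : ∀ i, Measure (X i)} [∀ i, SigmaFinite (μ i)]
    {f : ∀ i, X i → ℝ} (hf0 : ∀ i x, 0 ≤ f i x) (hf : ∀ i, Integrable (f i) (μ i))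
    {A : Set (∀ i, X i)} (hA : ∀ x ∈ A, 1 ≤ ∏ i, f i (x i)) :
    Measure.pi μ A ≤ ENNReal.ofReal (∏ i, ∫ x, f i x ∂(μ i)) := by
  have hint : Integrable (fun x : ∀ i, X i => ∏ i, f i (x i)) (Measure.pi μ) :=
    Integrable.fintype_prod_dep hf
  rw [← integral_fintype_prod_eq_prod (𝕜 := ℝ) f,
    ofReal_integral_eq_lintegral_ofReal hint
      (Eventually.of_forall fun x => Finset.prod_nonneg fun i _ => hf0 i _)]
  refine le_trans ?_ (mul_meas_ge_le_lintegral₀ hint.1.aemeasurable.ennreal_ofReal 1)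
  rw [one_mul]
  refine measure_mono fun x hx => ?_
  change 1 ≤ ENNReal.ofReal _
  rw [← ENNReal.ofReal_one]
  exact ENNReal.ofReal_le_ofReal (hA x hx)

theorem integrable_exp_sq_gaussianReal {v t : ℝ} (hv : 0 < v) (ht : t < 1) :
    Integrable (fun x => Real.exp (t * (x ^ 2 / (2 * v)))) (gaussianReal 0 v.toNNReal) ∧
      ∫ x, Real.exp (t * (x ^ 2 / (2 * v))) ∂(gaussianReal 0 v.toNNReal) = (√(1 - t))⁻¹ := by
  have hv' : v.toNNReal ≠ 0 := by simpa using hv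
  have hb : 0 < (1 - t) / (2 * v) := div_pos (by linarith) (by linarith)
  have h1 : ∀ x : ℝ, gaussianPDFReal 0 v.toNNReal x * Real.exp (t * (x ^ 2 / (2 * v))) =
      (√(2 * Real.pi * v))⁻¹ * Real.exp (-((1 - t) / (2 * v)) * x ^ 2) := fun x => by
    rw [gaussianPDFReal, Real.coe_toNNReal _ hv.le, mul_assoc, ← Real.exp_add]
    congr 2
    ring
  constructor
  · rw [gaussianReal_of_var_ne_zero _ hv', integrable_withDensity_iff_integrable_smul₀'
      (measurable_gaussianPDF _ _).aemeasurable (Eventually.of_forall fun _ => gaussianPDF_lt_top)]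
    simp only [toReal_gaussianPDF, smul_eq_mul, h1]
    exact (integrable_exp_neg_mul_sq hb).const_mul _
  · rw [integral_gaussianReal_eq_integral_smul hv']
    simp only [smul_eq_mul, h1]
    rw [integral_const_mul, integral_gaussian, ← Real.sqrt_inv, ← Real.sqrt_inv,
      ← Real.sqrt_mul (by positivity)]
    congr 1
    have : 1 - t ≠ 0 := by linarith
    field_simp

theorem integrable_exp_sq_complexGaussian {s t : ℝ} (hs : 0 < s) (ht : t < 1) :
    Integrable (fun z => Real.exp (t * (‖z‖ ^ 2 / s ^ 2))) (complexGaussian s) ∧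
      ∫ z, Real.exp (t * (‖z‖ ^ 2 / s ^ 2)) ∂(complexGaussian s) = (1 - t)⁻¹ := by
  obtain ⟨h1, h2⟩ := integrable_exp_sq_gaussianReal (v := s ^ 2 / 2) (by positivity) ht
  have h3 : ∀ x : ℝ × ℝ, Real.exp (t * (‖Complex.measurableEquivRealProd.symm x‖ ^ 2 / s ^ 2)) =
      Real.exp (t * (x.1 ^ 2 / (2 * (s ^ 2 / 2)))) * Real.exp (t * (x.2 ^ 2 / (2 * (s ^ 2 / 2)))) :=
    fun x => by
    rw [← Real.exp_add, ← Complex.normSq_eq_norm_sq, Complex.measurableEquivRealProd_symm_apply,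
      Complex.normSq_mk]
    congr 1
    field_simp
  constructor
  · rw [complexGaussian, integrable_map_equiv]
    exact (h1.mul_prod h1).congr (Eventually.of_forall fun x => (h3 x).symm)
  · rw [complexGaussian, integral_map_equiv]
    simp only [h3]
    rw [integral_prod_mul (fun x : ℝ => Real.exp (t * (x ^ 2 / (2 * (s ^ 2 / 2)))))
      (fun x : ℝ => Real.exp (t * (x ^ 2 / (2 * (s ^ 2 / 2))))), h2, ← mul_inv, Real.mul_self_sqrt (by linarith)]

instance (s : ℝ) : IsProbabilityMeasure (complexGaussian s) :=
  Measure.isProbabilityMeasure_map Complex.measurableEquivRealProd.symm.measurable.aemeasurable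

instance (n : ℕ) (s : ℝ) : IsProbabilityMeasure (noise n s) := by
  unfold noise; infer_instance

/-- The noise concentrates in a ball of squared radius `n s² (1 + δ)`. -/
theorem noise_tail_le (n : ℕ) {s δ : ℝ} (hs : 0 < s) (hδ : 0 < δ) :
    noise n s {z | n * s ^ 2 * (1 + δ) ≤ sqNorm z} ≤
      ENNReal.ofReal (((1 + δ) * Real.exp (-δ)) ^ n) := by
  -- `t = δ / (1 + δ)` is the optimal Chernoff parameter: it minimizes `e^{-t(1+δ)} / (1 - t)`, with
  -- minimum `(1 + δ) e^{-δ}`.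
  have ht : δ / (1 + δ) < 1 := by rw [div_lt_one (by linarith)]; linarith
  obtain ⟨h1, h2⟩ := integrable_exp_sq_complexGaussian hs ht
  have hδ' : 1 + δ ≠ 0 := by linarith
  have h3 : (∫ z, Real.exp (-δ) * Real.exp (δ / (1 + δ) * (‖z‖ ^ 2 / s ^ 2)) ∂complexGaussian s) =
      (1 + δ) * Real.exp (-δ) := by
    rw [integral_const_mul, h2, mul_comm]
    congr 1
    field_simp
    ring
  refine (pi_measure_le_prod_integral (f := fun (_ : Fin n) z =>
    Real.exp (-δ) * Real.exp (δ / (1 + δ) * (‖z‖ ^ 2 / s ^ 2))) (fun _ _ => by positivity)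
    (fun _ => h1.const_mul _) fun z hz => ?_).trans_eq ?_
  · have hz' : n * s ^ 2 * (1 + δ) ≤ ∑ i, ‖z i‖ ^ 2 := hz
    rw [Finset.prod_mul_distrib, Finset.prod_const, ← Real.exp_sum, ← Real.exp_nat_mul,
      ← Real.exp_add, Real.one_le_exp_iff, ← Finset.mul_sum, ← Finset.sum_div, Finset.card_univ,
      Fintype.card_fin]
    have h4 : n * δ = δ / (1 + δ) * (n * s ^ 2 * (1 + δ) / s ^ 2) := by field_simp
    have h5 : δ / (1 + δ) * (n * s ^ 2 * (1 + δ) / s ^ 2) ≤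
        δ / (1 + δ) * ((∑ i, ‖z i‖ ^ 2) / s ^ 2) := by gcongr
    linarith
  · simp only [h3, Finset.prod_const, Finset.card_univ, Fintype.card_fin]

/-- The volume of the set of the `x` for which `diag (h) x` lies in a ball. -/
theorem volume_sqNorm_le {n : ℕ} (hn : 0 < n) {R : ℝ} (hR : 0 < R) (h z : Fin n → ℂ)
    (hh : ∀ i, h i ≠ 0) :
    volume {x : Fin n → ℂ | sqNorm (fun i => h i * x i - z i) ≤ R} ≤
      ENNReal.ofReal ((Real.pi * Real.exp 1 * R / n) ^ n / ∏ i, ‖h i‖ ^ 2) := by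
  have hn' : (0 : ℝ) < n := by exact_mod_cast hn
  have hb : ∀ i, 0 < n / R * ‖h i‖ ^ 2 := fun i =>
    mul_pos (div_pos hn' hR) (pow_pos (norm_pos_iff.2 (hh i)) 2)
  -- The indicator of the ellipsoid is at most `exp (n - (n / R) ‖H x - z‖²)`, a product of
  -- Gaussians. This replaces `1/n!` in the exact volume by `(e/n)ⁿ`, a loss that is only
  -- subexponential.
  have h1 : ∀ i, ∀ x : ℂ, Real.exp (1 - n / R * ‖h i * x - z i‖ ^ 2) =
      Real.exp 1 * Real.exp (-(n / R * ‖h i‖ ^ 2) * ‖x - z i / h i‖ ^ 2) := fun i x => by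
    rw [← Real.exp_add]
    congr 1
    have : h i * x - z i = h i * (x - z i / h i) := by
      have := hh i
      field_simp
    rw [this, norm_mul]
    ring
  have h2 : ∀ i, ∫ x : ℂ, Real.exp (1 - n / R * ‖h i * x - z i‖ ^ 2) =
      Real.pi * Real.exp 1 * R / n / ‖h i‖ ^ 2 := fun i => by
    simp only [h1]
    rw [integral_const_mul,
      integral_sub_right_eq_self (fun x : ℂ => Real.exp (-(n / R * ‖h i‖ ^ 2) * ‖x‖ ^ 2)),
      GaussianFourier.integral_rexp_neg_mul_sq_norm (hb i), Complex.finrank_real_complex]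
    have := norm_ne_zero_iff.2 (hh i)
    norm_num
    field_simp
  have h3 : ∀ i, Integrable fun x : ℂ => Real.exp (1 - n / R * ‖h i * x - z i‖ ^ 2) := fun i => by
    refine Integrable.of_integral_ne_zero ?_
    rw [h2]
    have := norm_pos_iff.2 (hh i)
    positivity
  refine (pi_measure_le_prod_integral (μ := fun _ : Fin n => (volume : Measure ℂ))
    (f := fun i x => Real.exp (1 - n / R * ‖h i * x - z i‖ ^ 2)) (fun _ _ => by positivity)
    h3 fun x hx => ?_).trans_eq ?_
  · have hx' : ∑ i, ‖h i * x i - z i‖ ^ 2 ≤ R := hx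
    rw [← Real.exp_sum, Real.one_le_exp_iff, Finset.sum_sub_distrib, ← Finset.mul_sum]
    have : n / R * ∑ i, ‖h i * x i - z i‖ ^ 2 ≤ n / R * R := by gcongr
    rw [div_mul_cancel₀ _ hR.ne'] at this
    simpa using this
  · simp only [h2, Finset.prod_div_distrib, Finset.prod_const, Finset.card_univ, Fintype.card_fin]
    rw [div_pow]

/-! ### Monotonicity of the error probability in the noise -/

theorem complexGaussian_map_smul (c s : ℝ) :
    (complexGaussian s).map (fun z => c • z) = complexGaussian (c * s) := by
  have h1 : (gaussianReal 0 (s ^ 2 / 2).toNNReal).map (c * ·) =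
      gaussianReal 0 ((c * s) ^ 2 / 2).toNNReal := by
    rw [gaussianReal_map_const_mul, mul_zero]
    congr 1
    ext
    rw [NNReal.coe_mul, Real.coe_toNNReal _ (by positivity), Real.coe_toNNReal _ (by positivity)]
    change c ^ 2 * _ = _
    ring
  have h2 : (fun z : ℂ => c • z) ∘ Complex.measurableEquivRealProd.symm =
      Complex.measurableEquivRealProd.symm ∘ Prod.map (c * ·) (c * ·) := by
    ext x
    simp [Complex.measurableEquivRealProd_symm_apply, Complex.ext_iff]
  rw [complexGaussian, complexGaussian, Measure.map_map (by fun_prop)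
    (MeasurableEquiv.measurable _), h2, ← Measure.map_map (MeasurableEquiv.measurable _)
    (by fun_prop), ← Measure.map_prod_map _ _ (by fun_prop) (by fun_prop), h1]

theorem noise_map_smul (n : ℕ) (c s : ℝ) :
    (noise n s).map (fun z => c • z) = noise n (c * s) := by
  have : IsProbabilityMeasure ((complexGaussian s).map (fun z => c • z)) := by
    rw [complexGaussian_map_smul]; infer_instance
  have h1 := Measure.pi_map_pi (μ := fun _ : Fin n => complexGaussian s)
    (f := fun _ z => c • z) (fun _ => by fun_prop)
  simp only [complexGaussian_map_smul] at h1
  exact h1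

theorem continuous_sqNorm {n : ℕ} : Continuous (sqNorm (n := n)) := by
  unfold sqNorm; fun_prop

theorem isClosed_voronoiRegion {n : ℕ} (L : Set (Fin n → ℂ)) (x : Fin n → ℂ) :
    IsClosed (voronoiRegion L x) := by
  have : voronoiRegion L x = ⋂ x' ∈ L, {y | sqNorm (x - y) ≤ sqNorm (x' - y)} := by
    ext; simp [voronoiRegion]
  rw [this]
  exact isClosed_biInter fun x' _ => isClosed_le (continuous_sqNorm.comp (by fun_prop))
    (continuous_sqNorm.comp (by fun_prop))

theorem sqNorm_sub_smul {n : ℕ} (x z : Fin n → ℂ) (c : ℝ) :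
    sqNorm (x - c • z) = c * sqNorm (x - z) + (1 - c) * sqNorm x - c * (1 - c) * sqNorm z := by
  simp only [sqNorm, Finset.mul_sum]
  rw [← Finset.sum_add_distrib, ← Finset.sum_sub_distrib]
  refine Finset.sum_congr rfl fun i _ => ?_
  simp only [Pi.sub_apply, Pi.smul_apply, Complex.sq_norm, Complex.normSq_apply, Complex.sub_re,
    Complex.sub_im, Complex.smul_re, Complex.smul_im, smul_eq_mul]
  ring

theorem sqNorm_nonneg {n : ℕ} (x : Fin n → ℂ) : 0 ≤ sqNorm x :=
  Finset.sum_nonneg fun _ _ => sq_nonneg _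

theorem sqNorm_zero_sub {n : ℕ} (x : Fin n → ℂ) : sqNorm (0 - x) = sqNorm x := by
  simp [sqNorm]

/-- Voronoi regions of the origin are star-shaped. -/
theorem smul_mem_voronoiRegion {n : ℕ} {L : Set (Fin n → ℂ)} {z : Fin n → ℂ} {c : ℝ} (h0 : 0 ≤ c)
    (h1 : c ≤ 1) (hz : z ∈ voronoiRegion L 0) : c • z ∈ voronoiRegion L 0 := fun x hx => by
  have h2 := hz x hx
  have h3 := sqNorm_sub_smul 0 z c
  rw [sqNorm_zero_sub] at h2
  rw [sqNorm_sub_smul, sqNorm_sub_smul, sqNorm_zero_sub]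
  have h4 : sqNorm (0 : Fin n → ℂ) = 0 := by simp [sqNorm]
  rw [h4, mul_zero]
  have h5 := mul_le_mul_of_nonneg_left h2 h0
  have h6 := mul_nonneg (sub_nonneg.2 h1) (sqNorm_nonneg x)
  linarith

/-- Noise at level `s` is noise at level `s'` shrunk by `s / s' ≤ 1`, and shrinking preserves the
Voronoi region of the origin. -/
theorem errorProb_mono {Ω : Type*} [MeasurableSpace Ω] (P : Measure Ω) (h : ℕ → Ω → ℂ) {n : ℕ}
    (L : Submodule ℤ (Fin n → ℂ)) {s s' : ℝ} (hs : 0 < s) (hss' : s ≤ s') :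
    errorProb P h L s ≤ errorProb P h L s' := by
  refine lintegral_mono fun ω => ?_
  have hs' : 0 < s' := hs.trans_le hss'
  have h1 := noise_map_smul n (s / s') s'
  rw [div_mul_cancel₀ _ hs'.ne'] at h1
  rw [← h1, Measure.map_apply (by fun_prop) (isClosed_voronoiRegion _ _).isOpen_compl.measurableSet]
  exact measure_mono fun z hz hz' => hz (smul_mem_voronoiRegion (div_nonneg hs.le hs'.le)
    ((div_le_one hs').2 hss') hz')

theorem sqrt_sqNorm {n : ℕ} (x : Fin n → ℂ) : √(sqNorm x) = ‖WithLp.toLp 2 x‖ := by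
  rw [EuclideanSpace.norm_eq]; rfl

theorem sqrt_sqNorm_add_le {n : ℕ} (x y : Fin n → ℂ) :
    √(sqNorm (x + y)) ≤ √(sqNorm x) + √(sqNorm y) := by
  simp only [sqrt_sqNorm, WithLp.toLp_add]
  exact norm_add_le _ _

theorem norm_apply_le_sqrt_sqNorm {n : ℕ} (x : Fin n → ℂ) (i : Fin n) : ‖x i‖ ≤ √(sqNorm x) :=
  Real.le_sqrt_of_sq_le
    (Finset.single_le_sum (f := fun i => ‖x i‖ ^ 2) (fun _ _ => sq_nonneg _) (Finset.mem_univ i))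

theorem sqrt_sqNorm_le {n : ℕ} {x : Fin n → ℂ} {B : ℝ} (h : ∀ i, ‖x i‖ ≤ B) (hB : 0 ≤ B) :
    √(sqNorm x) ≤ √n * B := by
  refine Real.sqrt_le_iff.2 ⟨by positivity, ?_⟩
  rw [mul_pow, Real.sq_sqrt (Nat.cast_nonneg n)]
  refine (Finset.sum_le_card_nsmul _ _ (B ^ 2) fun i _ => ?_).trans_eq (by simp)
  exact pow_le_pow_left₀ (norm_nonneg _) (h i) 2

/-! ### A balanced family of codes -/

/-- The multiples of a subspace of the field of `p ^ n` elements: a family of `p ^ n - 1` codes of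
which at most `p ^ k - 1` contain a given nonzero vector. -/
theorem exists_balanced_codes (p : ℕ) [Fact p.Prime] {n k : ℕ} (hn : 0 < n) (hk : k ≤ n) :
    ∃ (U : Type) (_ : Fintype U) (C : U → Submodule (ZMod p) (Fin n → ZMod p)),
      Fintype.card U = p ^ n - 1 ∧ (∀ u, Module.finrank (ZMod p) (C u) = k) ∧
      ∀ v, v ≠ 0 → ∀ S : Finset U, (∀ u ∈ S, v ∈ C u) → S.card ≤ p ^ k - 1 := by
  classical
  let F := GaloisField p n
  have hF : Module.finrank (ZMod p) F = n := GaloisField.finrank p hn.ne'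
  have : Finite F := Module.finite_of_finite (ZMod p)
  have := Fintype.ofFinite F
  let e : F ≃ₗ[ZMod p] (Fin n → ZMod p) :=
    LinearEquiv.ofFinrankEq _ _ (by rw [hF, Module.finrank_fin_fun])
  obtain ⟨C₀, hC₀⟩ : ∃ C₀ : Submodule (ZMod p) F, Module.finrank (ZMod p) C₀ = k := by
    let b := Module.finBasisOfFinrankEq (ZMod p) F hF
    refine ⟨Submodule.span (ZMod p) (Set.range (b ∘ Fin.castLE hk)), ?_⟩
    rw [finrank_span_eq_card (b.linearIndependent.comp _ (Fin.castLE_injective hk)),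
      Fintype.card_fin]
  let m : Fˣ → F ≃ₗ[ZMod p] F := fun u => DistribMulAction.toLinearEquiv (ZMod p) F u
  refine ⟨Fˣ, inferInstance, fun u => C₀.map (m u ≪≫ₗ e : F →ₗ[ZMod p] (Fin n → ZMod p)), ?_,
    fun u => ?_, fun v hv S hS => ?_⟩
  · rw [Fintype.card_units, ← Nat.card_eq_fintype_card, GaloisField.card p n hn.ne']
  · rw [← hC₀]
    exact LinearEquiv.finrank_map_eq (m u ≪≫ₗ e) C₀
  · have hcard : (Finset.univ.filter fun x : F => x ∈ C₀).card = p ^ k := by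
      rw [← Fintype.card_subtype, ← Nat.card_eq_fintype_card]
      have h1 := Module.natCard_eq_pow_finrank (K := ZMod p) (V := C₀)
      rwa [Nat.card_zmod, hC₀] at h1
    rw [← hcard, ← Finset.card_erase_of_mem (by simp : (0 : F) ∈ _)]
    have hv' : e.symm v ≠ 0 := by simpa using hv
    -- `v` lies in the code of `u` exactly when `u⁻¹ v` lies in `C₀`, and distinct units give
    -- distinct nonzero elements of `C₀`.
    refine Finset.card_le_card_of_injOn (fun u => u⁻¹ • e.symm v) (fun u hu => ?_)
      fun u _ u' _ huu' => ?_
    · obtain ⟨w, hw, hwv⟩ := hS u hu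
      have h1 : e.symm v = u • w := by rw [← hwv]; exact e.symm_apply_apply _
      have h2 : u⁻¹ • e.symm v = w := by rw [h1, inv_smul_smul]
      have h3 : u⁻¹ • e.symm v ≠ 0 := (smul_ne_zero_iff_ne _).2 hv'
      simp only [Finset.coe_erase, Set.mem_sdiff, Set.mem_singleton_iff]
      exact ⟨by simpa [h2] using hw, h3⟩
    · have h1 : ((u⁻¹ : Fˣ) : F) * e.symm v = ((u'⁻¹ : Fˣ) : F) * e.symm v := huu'
      exact inv_injective (Units.ext (mul_right_cancel₀ hv' h1))

/-! ### Averaging over the codes -/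

/-- `D` bounds a fundamental domain of `L`: the points `x` of `L` such that `A` contains the
scaled translates `a (x + w)`, `‖w‖ ≤ D`, are at most `μ A / (a ^ d covol L)` in number. -/
def PackingBound {n : ℕ} (L : Submodule ℤ (Fin n → ℂ)) (D : ℝ) : Prop :=
  ∀ (a : ℝ), 0 < a → ∀ (T : Finset (Fin n → ℂ)), (T : Set (Fin n → ℂ)) ⊆ L →
    ∀ A : Set (Fin n → ℂ), (∀ x ∈ T, ∀ w : Fin n → ℂ, ‖w‖ ≤ D → a • (x + w) ∈ A) →
      T.card * ENNReal.ofReal (a ^ (2 * n) * ZLattice.covolume L) ≤ volume A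

/-- The code families in which every nonzero vector lies in at most `N` codes. -/
def BalancedCodes {n p : ℕ} {U : Type} (C : U → Submodule (ZMod p) (Fin n → ZMod p)) (N : ℕ) :
    Prop :=
  ∀ v, v ≠ 0 → ∀ S : Finset U, (∀ u ∈ S, v ∈ C u) → S.card ≤ N

theorem norm_apply_le_of_sqNorm_le {n : ℕ} {a b R : ℝ} (ha : 0 < a) (hb : 0 < b)
    {h z v : Fin n → ℂ} (hh : ∀ i, b ≤ ‖h i‖) (hz : sqNorm z ≤ R)
    (hv : sqNorm (fun i => h i * (a • v) i - z i) ≤ R) (i : Fin n) :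
    ‖v i‖ ≤ 2 * √R / (a * b) := by
  have h1 : ‖h i * (a • v) i‖ ≤ 2 * √R := by
    have h2 := norm_apply_le_sqrt_sqNorm (fun i => h i * (a • v) i - z i) i
    have h3 := norm_apply_le_sqrt_sqNorm z i
    have h4 := norm_add_le (h i * (a • v) i - z i) (z i)
    rw [sub_add_cancel] at h4
    linarith [Real.sqrt_le_sqrt hv, Real.sqrt_le_sqrt hz]
  rw [Pi.smul_apply, norm_mul, norm_smul, Real.norm_of_nonneg ha.le] at h1
  rw [le_div_iff₀ (mul_pos ha hb)]
  calc ‖v i‖ * (a * b) = b * (a * ‖v i‖) := by ring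
    _ ≤ ‖h i‖ * (a * ‖v i‖) := by gcongr; exact hh i
    _ ≤ _ := h1

/-- The passage from `R` to `R'` absorbs a scaled fundamental cell after fading by at most `B`, as
the packing bound requires. -/
theorem sqNorm_sub_le_of_perturbation {n : ℕ} (hn : 0 < n) {a B D R R' : ℝ} (ha : 0 < a)
    (hB : 0 < B) (hD : 0 < D) (hR' : √R + √n * (B * (a * D)) ≤ √R') {h z v w : Fin n → ℂ}
    (hh : ∀ i, ‖h i‖ ≤ B) (hv : sqNorm (fun i => h i * (a • v) i - z i) ≤ R) (hw : ‖w‖ ≤ D) :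
    sqNorm (fun i => h i * (a • (v + w)) i - z i) ≤ R' := by
  have h1 : (fun i => h i * (a • (v + w)) i - z i) =
      (fun i => h i * (a • v) i - z i) + fun i => h i * (a • w) i := by
    ext i
    simp only [Pi.add_apply, Pi.smul_apply, smul_add]
    ring
  have h2 : √(sqNorm fun i => h i * (a • w) i) ≤ √n * (B * (a * D)) := by
    refine sqrt_sqNorm_le (fun i => ?_) (by positivity)
    rw [Pi.smul_apply, norm_mul, norm_smul, Real.norm_of_nonneg ha.le]
    have h3 := (norm_le_pi_norm w i).trans hw
    gcongr
    exact hh i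
  have hn' : (0 : ℝ) < n := by exact_mod_cast hn
  have hR'0 : 0 < √R' := lt_of_lt_of_le (by positivity) hR'
  have h4 := (sqrt_sqNorm_add_le (fun i => h i * (a • v) i - z i)
    fun i => h i * (a • w) i).trans (add_le_add (Real.sqrt_le_sqrt hv) h2)
  rw [← h1] at h4
  exact (Real.sqrt_le_sqrt_iff (Real.sqrt_pos.1 hR'0).le).1 (h4.trans hR')

namespace CyclicExtension

variable {n : ℕ} (E : CyclicExtension n)

theorem exists_packingBound (hn : 0 < n) : ∃ D, 0 < D ∧ PackingBound E.integerLattice D := by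
  have hM := E.isFullLattice_integerLattice hn
  have := hM.1
  have : IsZLattice ℝ E.integerLattice := ⟨hM.2⟩
  obtain ⟨D, hD0, hD⟩ := exists_packing_bound volume E.integerLattice
  have h1 : Module.finrank ℝ (Fin n → ℂ) = 2 * n := by
    simp [Module.finrank_pi_fintype, Complex.finrank_real_complex, mul_comm]
  rw [h1] at hD
  exact ⟨D, hD0, hD⟩

/-- Double counting for fixed fading and noise: `hker` excludes dangerous points with zero residues,
each remaining one lies in at most `N` codes, and packing bounds their number. -/
theorem card_codes_le (hn : 0 < n) {p : ℕ} [Fact p.Prime] (ψ : 𝓞 E.K →+* ZMod p)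
    (hψ : Function.Injective fun i : Fin n => ψ.comp (E.relEmb i)) {U : Type}
    {C : U → Submodule (ZMod p) (Fin n → ZMod p)} {N : ℕ} (hC : BalancedCodes C N)
    {D : ℝ} (hD0 : 0 < D) (hD : PackingBound E.integerLattice D) {a b B R R' : ℝ} (ha : 0 < a)
    (hb : 0 < b) (hB : 0 < B) (hker : (2 * √R / (a * b)) ^ (2 * n) < p ^ n)
    (hR' : √R + √n * (B * (a * D)) ≤ √R') {h z : Fin n → ℂ} (hh : ∀ i, b ≤ ‖h i‖ ∧ ‖h i‖ ≤ B)
    (hz : sqNorm z ≤ R) {S : Finset U}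
    (hS : ∀ u ∈ S, ∃ x, x ≠ 0 ∧ E.residues ψ x ∈ C u ∧
      sqNorm (fun i => h i * (a • E.canonicalEmb x) i - z i) ≤ R) :
    S.card * ENNReal.ofReal (a ^ (2 * n) * ZLattice.covolume E.integerLattice) ≤
      N * volume {x : Fin n → ℂ | sqNorm (fun i => h i * x i - z i) ≤ R'} := by
  classical
  have hR0 : 0 ≤ R := (sqNorm_nonneg z).trans hz
  have hbound : ∀ v : Fin n → ℂ, sqNorm (fun i => h i * (a • v) i - z i) ≤ R →
      ∀ i, ‖v i‖ ≤ 2 * √R / (a * b) := fun v hv i =>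
    norm_apply_le_of_sqNorm_le ha hb (fun i => (hh i).1) hz hv i
  have hres : ∀ x, x ≠ 0 → sqNorm (fun i => h i * (a • E.canonicalEmb x) i - z i) ≤ R →
      E.residues ψ x ≠ 0 := fun x hx hxR h0 =>
    hker.not_ge (E.pow_le_of_reduction_eq_zero hn ψ hψ hx (fun i => congrFun h0 i)
      (hbound _ hxR))
  let W : Set (Fin n → ℂ) := {v | v ∈ E.integerLattice ∧
    sqNorm (fun i => h i * (a • v) i - z i) ≤ R}
  have hW : W.Finite := by
    refine (E.integerLattice_inter_closedBall_finite hn (2 * √R / (a * b))).subset ?_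
    rintro v ⟨hv, hvR⟩
    refine ⟨hv, mem_closedBall_zero_iff.2 ((pi_norm_le_iff_of_nonneg (by positivity)).2
      (hbound v hvR))⟩
  choose! x hx0 hxC hxR using hS
  have hcard : S.card ≤ hW.toFinset.card * N := by
    rw [mul_comm]
    refine Finset.card_le_mul_card_image_of_maps_to (f := fun u => E.canonicalEmb (x u))
      (fun u hu => hW.mem_toFinset.2 ⟨⟨x u, rfl⟩, hxR u hu⟩) N fun v hv => ?_
    by_cases hne : (S.filter fun u => E.canonicalEmb (x u) = v).Nonempty
    · obtain ⟨u₀, hu₀⟩ := hne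
      obtain ⟨hu₀S, hu₀v⟩ := Finset.mem_filter.1 hu₀
      refine hC _ (hres _ (hx0 u₀ hu₀S) (hxR u₀ hu₀S)) _ fun u hu => ?_
      obtain ⟨huS, huv⟩ := Finset.mem_filter.1 hu
      rw [← E.canonicalEmb_injective hn (huv.trans hu₀v.symm)]
      exact hxC u huS
    · rw [Finset.not_nonempty_iff_eq_empty.1 hne]
      exact Nat.zero_le _
  have hpack := hD a ha hW.toFinset (fun v hv => (hW.mem_toFinset.1 hv).1)
    {x : Fin n → ℂ | sqNorm (fun i => h i * x i - z i) ≤ R'} fun v hv w hw =>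
      sqNorm_sub_le_of_perturbation hn ha hB hD0 hR' (fun i => (hh i).2)
        (hW.mem_toFinset.1 hv).2 hw
  have hcard' : (S.card : ENNReal) ≤ hW.toFinset.card * N := by exact_mod_cast hcard
  generalize ENNReal.ofReal (a ^ (2 * n) * ZLattice.covolume E.integerLattice) = K at hpack ⊢
  refine (mul_le_mul_left hcard' K).trans ?_
  rw [mul_right_comm, mul_comm]
  exact mul_le_mul_right hpack (N : ENNReal)

/-- For fixed fading coefficients, the sum over the codes of the error probabilities. -/
theorem sum_noise_le (hn : 0 < n) {p : ℕ} [Fact p.Prime] (ψ : 𝓞 E.K →+* ZMod p)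
    (hψ : Function.Injective fun i : Fin n => ψ.comp (E.relEmb i)) {U : Type} [Fintype U]
    {C : U → Submodule (ZMod p) (Fin n → ZMod p)} {N : ℕ} (hC : BalancedCodes C N)
    {D : ℝ} (hD0 : 0 < D) (hD : PackingBound E.integerLattice D) {a b B R R' s : ℝ} (ha : 0 < a)
    (hb : 0 < b) (hB : 0 < B) (hR : 0 < R) (hker : (2 * √R / (a * b)) ^ (2 * n) < p ^ n)
    (hR' : √R + √n * (B * (a * D)) ≤ √R') {c : ℕ → ℂ}
    (hc : ∀ i : Fin n, b ≤ ‖c i‖ ∧ ‖c i‖ ≤ B) :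
    ∑ u, noise n s (voronoiRegion (faded c (a • E.codeLattice ψ (C u))) 0)ᶜ ≤
      Fintype.card U * noise n s {z | R ≤ sqNorm z} +
        N * ENNReal.ofReal ((Real.pi * Real.exp 1 * R' / n) ^ n / (∏ i : Fin n, ‖c i‖ ^ 2) /
          (a ^ (2 * n) * ZLattice.covolume E.integerLattice)) := by
  classical
  -- `A u` contains the errors with small noise. Strict inequalities make it open, hence measurable.
  let A : U → Set (Fin n → ℂ) := fun u => {z | sqNorm z < R} ∩
    ⋃ x : {x : 𝓞 E.K // x ≠ 0 ∧ E.residues ψ x ∈ C u},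
      {z | sqNorm (fun i => c i * (a • E.canonicalEmb x) i - z i) < R}
  have hA : ∀ u, IsOpen (A u) := fun u =>
    (isOpen_lt continuous_sqNorm continuous_const).inter (isOpen_iUnion fun x =>
      isOpen_lt (continuous_sqNorm.comp (by fun_prop)) continuous_const)
  have hsub : ∀ u, (voronoiRegion (faded c (a • E.codeLattice ψ (C u))) 0)ᶜ ⊆
      {z | R ≤ sqNorm z} ∪ A u := fun u z hz => by
    by_cases hzR : R ≤ sqNorm z
    · exact Or.inl hzR
    · refine Or.inr ⟨not_le.1 hzR, ?_⟩
      simp only [voronoiRegion, Set.mem_compl_iff, Set.mem_ofPred_eq, not_forall, not_le] at hz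
      obtain ⟨_, ⟨_, ⟨_, ⟨x, hx, rfl⟩, rfl⟩, rfl⟩, hlt⟩ := hz
      rw [sqNorm_zero_sub] at hlt
      refine Set.mem_iUnion.2 ⟨⟨x, ?_, hx⟩, hlt.trans (not_le.1 hzR)⟩
      rintro rfl
      refine hlt.ne ?_
      change sqNorm ((fun i : Fin n => c i * (a • E.canonicalEmb 0) i) - z) = sqNorm z
      rw [map_zero, ← sqNorm_zero_sub z]
      congr 2
      ext i
      simp
  set q : ENNReal := ENNReal.ofReal ((Real.pi * Real.exp 1 * R' / n) ^ n /
    (∏ i : Fin n, ‖c i‖ ^ 2) / (a ^ (2 * n) * ZLattice.covolume E.integerLattice)) with hq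
  have hM := E.isFullLattice_integerLattice hn
  have := hM.1
  have : IsZLattice ℝ E.integerLattice := ⟨hM.2⟩
  have hcov : 0 < a ^ (2 * n) * ZLattice.covolume E.integerLattice :=
    mul_pos (pow_pos ha _) (ZLattice.covolume_pos _ _)
  have hR'0 : 0 < R' := Real.sqrt_pos.1 (lt_of_lt_of_le (by positivity) hR')
  have hpt : ∀ z, ∑ u, (A u).indicator (1 : (Fin n → ℂ) → ENNReal) z ≤ N * q := fun z => by
    by_cases hz : sqNorm z < R
    · have h1 : ∑ u, (A u).indicator (1 : (Fin n → ℂ) → ENNReal) z =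
          ((Finset.univ.filter fun u => z ∈ A u).card : ENNReal) := by
        simp only [Set.indicator_apply, Pi.one_apply]
        exact Finset.sum_boole _ _
      have h2 := E.card_codes_le hn ψ hψ hC hD0 hD ha hb hB hker hR' hc hz.le
        (S := Finset.univ.filter fun u => z ∈ A u) fun u hu => by
          obtain ⟨x, hx⟩ := Set.mem_iUnion.1 (Finset.mem_filter.1 hu).2.2
          exact ⟨x, x.2.1, x.2.2, hx.le⟩
      have h3 := volume_sqNorm_le hn hR'0 (fun i : Fin n => c i) z fun i =>
        norm_pos_iff.1 (hb.trans_le (hc i).1)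
      have h4 := h2.trans (mul_le_mul_right h3 (N : ENNReal))
      rw [h1, hq, ENNReal.ofReal_div_of_pos hcov, ← mul_div_assoc,
        ENNReal.le_div_iff_mul_le (Or.inl (ENNReal.ofReal_pos.2 hcov).ne')
          (Or.inl ENNReal.ofReal_ne_top)]
      exact h4
    · have h1 : ∀ u, z ∉ A u := fun u hu => hz hu.1
      simp [Set.indicator_of_notMem (h1 _)]
  calc ∑ u, noise n s (voronoiRegion (faded c (a • E.codeLattice ψ (C u))) 0)ᶜ
      ≤ ∑ u, (noise n s {z | R ≤ sqNorm z} + noise n s (A u)) :=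
        Finset.sum_le_sum fun u _ => (measure_mono (hsub u)).trans (measure_union_le _ _)
    _ = Fintype.card U * noise n s {z | R ≤ sqNorm z} +
          ∫⁻ z, ∑ u, (A u).indicator (1 : (Fin n → ℂ) → ENNReal) z ∂noise n s := by
        rw [Finset.sum_add_distrib, lintegral_finsetSum _ fun u _ =>
          measurable_one.indicator (hA u).measurableSet]
        simp [lintegral_indicator_one (hA _).measurableSet]
    _ ≤ _ := by
        gcongr
        exact (lintegral_mono hpt).trans_eq (by simp)

end CyclicExtension

/-! ### Averaging over the fading and the choice of the code -/

/-- Superadditivity of the lower integral suffices, so measurability of the error probability in the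
fading is not needed. -/
theorem sum_lintegral_le {Ω U : Type*} [MeasurableSpace Ω] (P : Measure Ω) (S : Finset U)
    (f : U → Ω → ENNReal) : ∑ u ∈ S, ∫⁻ ω, f u ω ∂P ≤ ∫⁻ ω, ∑ u ∈ S, f u ω ∂P := by
  classical
  induction S using Finset.induction_on with
  | empty => simp
  | insert u S hu ih =>
    simp only [Finset.sum_insert hu]
    exact (add_le_add_right ih _).trans (le_lintegral_add _ _)

/-- The best code is at least as good as the average one; outside `G` the trivial bound `1` is used.
-/
theorem exists_lintegral_le {Ω U : Type*} [MeasurableSpace Ω] (P : Measure Ω)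
    [IsProbabilityMeasure P] [Fintype U] [Nonempty U] (f : U → Ω → ENNReal) (hf : ∀ u ω, f u ω ≤ 1)
    {G : Set Ω} (hG : MeasurableSet G) {q : ENNReal}
    (hq : ∀ ω ∈ G, ∑ u, f u ω ≤ Fintype.card U * q) : ∃ u, ∫⁻ ω, f u ω ∂P ≤ P Gᶜ + q := by
  obtain ⟨u, -, hu⟩ := Finset.exists_min_image Finset.univ (fun u => ∫⁻ ω, f u ω ∂P)
    Finset.univ_nonempty
  refine ⟨u, ?_⟩
  have hU : (Fintype.card U : ENNReal) ≠ 0 := by exact_mod_cast Fintype.card_ne_zero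
  rw [← ENNReal.mul_le_mul_iff_right hU (ENNReal.natCast_ne_top _)]
  calc Fintype.card U * ∫⁻ ω, f u ω ∂P = ∑ _u : U, ∫⁻ ω, f u ω ∂P := by simp
    _ ≤ ∑ u, ∫⁻ ω, f u ω ∂P := Finset.sum_le_sum fun v hv => hu v hv
    _ ≤ ∫⁻ ω, ∑ u, f u ω ∂P := sum_lintegral_le P _ f
    _ ≤ ∫⁻ ω, (Fintype.card U * Gᶜ.indicator 1 ω + Fintype.card U * q) ∂P := by
        refine lintegral_mono fun ω => ?_
        by_cases hω : ω ∈ G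
        · exact (hq ω hω).trans le_add_self
        · rw [Set.indicator_of_mem (show ω ∈ Gᶜ from hω)]
          refine le_add_right ((Finset.sum_le_sum fun u _ => hf u ω).trans_eq ?_)
          simp
    _ = Fintype.card U * (P Gᶜ + q) := by
        rw [lintegral_add_right _ measurable_const, lintegral_const_mul _
          (measurable_one.indicator hG.compl), lintegral_indicator_one hG.compl, lintegral_const,
          measure_univ, mul_one, mul_add]

/-- Finitely many fading coefficients lie in a compact subset of `ℂˣ` with high probability. -/
theorem exists_truncation {Ω : Type*} [MeasurableSpace Ω] (P : Measure Ω) [IsProbabilityMeasure P]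
    {h : ℕ → Ω → ℂ} (hm : ∀ i, Measurable (h i)) (h0 : ∀ i, ∀ᵐ ω ∂P, h i ω ≠ 0) (n : ℕ)
    {η : ENNReal} (hη : η ≠ 0) : ∃ B : ℝ, 0 < B ∧ ∃ G : Set Ω, MeasurableSet G ∧ P Gᶜ ≤ η ∧
      ∀ ω ∈ G, ∀ i < n, B⁻¹ ≤ ‖h i ω‖ ∧ ‖h i ω‖ ≤ B := by
  let G : ℕ → Set Ω := fun m => {ω | ∀ i < n, ((m : ℝ) + 1)⁻¹ ≤ ‖h i ω‖ ∧ ‖h i ω‖ ≤ m + 1}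
  have hG : ∀ m, MeasurableSet (G m) := fun m => by
    have : G m = ⋂ i, ⋂ (_ : i < n), ({ω | ((m : ℝ) + 1)⁻¹ ≤ ‖h i ω‖} ∩ {ω | ‖h i ω‖ ≤ m + 1}) := by
      ext; simp [G]
    rw [this]
    exact MeasurableSet.iInter fun i => MeasurableSet.iInter fun _ =>
      (measurableSet_le measurable_const (hm i).norm).inter
        (measurableSet_le (hm i).norm measurable_const)
  have hmono : Antitone fun m => (G m)ᶜ := fun m m' hmm' => Set.compl_subset_compl.2 fun ω hω i hi => by
    have hc : (m : ℝ) + 1 ≤ m' + 1 := by exact_mod_cast Nat.succ_le_succ hmm'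
    exact ⟨(inv_anti₀ (by positivity) hc).trans (hω i hi).1, (hω i hi).2.trans hc⟩
  have hnull : P (⋂ m, (G m)ᶜ) = 0 := by
    have hae : ∀ᵐ ω ∂P, ∀ i, h i ω ≠ 0 := ae_all_iff.2 h0
    refine measure_mono_null (t := {ω | ¬ ∀ i, h i ω ≠ 0})
      (fun ω hω (hne : ∀ i, h i ω ≠ 0) => ?_) (ae_iff.1 hae)
    rw [Set.mem_iInter] at hω
    have hev : ∀ i, ∀ᶠ m : ℕ in atTop, ((m : ℝ) + 1)⁻¹ ≤ ‖h i ω‖ ∧ ‖h i ω‖ ≤ m + 1 := fun i => by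
      have hpos : 0 < ‖h i ω‖ := norm_pos_iff.2 (hne i)
      filter_upwards [tendsto_natCast_atTop_atTop.eventually_ge_atTop (max ‖h i ω‖⁻¹ ‖h i ω‖)]
        with m hm
      refine ⟨?_, by linarith [le_max_right ‖h i ω‖⁻¹ ‖h i ω‖]⟩
      rw [inv_le_comm₀ (by positivity) hpos]
      linarith [le_max_left ‖h i ω‖⁻¹ ‖h i ω‖]
    obtain ⟨m, hm⟩ := ((Finset.range n).eventually_all.2 fun i _ => hev i).exists
    exact hω m fun i hi => hm i (Finset.mem_range.2 hi)
  have hlim := tendsto_measure_iInter_atTop (μ := P) (fun m => (hG m).compl.nullMeasurableSet) hmono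
    ⟨0, measure_ne_top _ _⟩
  rw [hnull] at hlim
  obtain ⟨m, hm⟩ := (hlim.eventually_le_const (pos_iff_ne_zero.2 hη)).exists
  exact ⟨m + 1, by positivity, G m, hG m, hm, fun ω hω => hω⟩

namespace CyclicExtension

variable {n : ℕ} (E : CyclicExtension n)

theorem normFactor_pos {k p : ℕ} {β : ℝ} (hβ : 0 < β) (hp : 0 < p) : 0 < E.normFactor k p β := by
  have hΔ : (discr E.K : ℝ) ≠ 0 := by exact_mod_cast discr_ne_zero E.K
  have hp' : (0 : ℝ) < p := by exact_mod_cast hp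
  unfold normFactor
  positivity

theorem normFactor_pow {k p : ℕ} (hk : k ≤ n) (hn : 0 < n) {β : ℝ} (hβ : 0 < β) (hp : 0 < p) :
    E.normFactor k p β ^ (2 * n) = (β * (2⁻¹ ^ n * √|(discr E.K : ℝ)|) * p ^ (n - k))⁻¹ := by
  have hΔ : (discr E.K : ℝ) ≠ 0 := by exact_mod_cast discr_ne_zero E.K
  have hp' : (0 : ℝ) < p := by exact_mod_cast hp
  have hn' : (n : ℝ) ≠ 0 := by exact_mod_cast hn.ne'
  rw [normFactor, ← Real.rpow_natCast, ← Real.rpow_mul (by positivity), ← Nat.cast_sub hk,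
    Real.rpow_natCast, show -(1 / (2 * (n : ℝ))) * ((2 * n : ℕ) : ℝ) = -1 by
      push_cast; field_simp, Real.rpow_neg_one]
  congr 1
  ring

end CyclicExtension

theorem exp_le_prod_sq_norm {n : ℕ} (hn : 0 < n) {c : ℕ → ℂ} (hc : ∀ i < n, c i ≠ 0) {μ ε : ℝ}
    (h : |(1 / (n : ℝ)) * ∑ i ∈ Finset.range n, Real.log ‖c i‖ - μ| ≤ ε) :
    Real.exp (2 * (μ - ε)) ^ n ≤ ∏ i : Fin n, ‖c i‖ ^ 2 := by
  have hn' : (0 : ℝ) < n := by exact_mod_cast hn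
  have h1 := (abs_le.1 h).1
  have h2 : μ - ε ≤ 1 / (n : ℝ) * ∑ i ∈ Finset.range n, Real.log ‖c i‖ := by linarith
  rw [one_div_mul_eq_div, le_div_iff₀ hn', Finset.sum_range] at h2
  have h3 : ∏ i : Fin n, ‖c i‖ ^ 2 = Real.exp (2 * ∑ i : Fin n, Real.log ‖c i‖) := by
    rw [Finset.mul_sum, Real.exp_sum]
    refine Finset.prod_congr rfl fun i _ => ?_
    rw [two_mul, Real.exp_add, Real.exp_log (norm_pos_iff.2 (hc i i.2)), sq]
  rw [h3, ← Real.exp_nat_mul]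
  exact Real.exp_le_exp.2 (by linarith)

/-- The size of the union bound, for codes with `p ^ k` words out of `p ^ n`. -/
theorem union_bound_le {n k p : ℕ} (hn : 0 < n) (hkn : k ≤ n) (hp : 1 < p) {cov c s γ δ m Z : ℝ}
    (hcov : 0 < cov) (hc : 0 < c) (hs : 0 < s) (hγ : 0 < γ) (hδ : 0 < δ) (hm : 0 < m)
    (hV : cov / c = (γ * s ^ 2) ^ n) (hZ : m ^ n ≤ Z) :
    ((p ^ k - 1 : ℕ) : ENNReal) * ENNReal.ofReal
        ((Real.pi * Real.exp 1 * (n * s ^ 2 * (1 + δ) * (1 + δ)) / n) ^ n / Z /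
          ((c * p ^ (n - k))⁻¹ * cov)) ≤
      ((p ^ n - 1 : ℕ) : ENNReal) *
        ENNReal.ofReal ((Real.pi * Real.exp 1 * (1 + δ) ^ 2 / (m * γ)) ^ n) := by
  have hn' : (n : ℝ) ≠ 0 := by exact_mod_cast hn.ne'
  have hp' : (1 : ℝ) < p := by exact_mod_cast hp
  have hmn : 0 < m ^ n := pow_pos hm n
  have hQ : (Real.pi * Real.exp 1 * (n * s ^ 2 * (1 + δ) * (1 + δ)) / n) ^ n / Z /
      ((c * p ^ (n - k))⁻¹ * cov) ≤
      p ^ (n - k) * (Real.pi * Real.exp 1 * (1 + δ) ^ 2 / (m * γ)) ^ n := by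
    have hcov' : cov = c * (γ * s ^ 2) ^ n := by rw [← hV]; field_simp
    have h1 : (Real.pi * Real.exp 1 * (n * s ^ 2 * (1 + δ) * (1 + δ)) / n) =
        (Real.pi * Real.exp 1 * (1 + δ) ^ 2 / (m * γ)) * m * (γ * s ^ 2) := by
      field_simp
    have h2 : (c * (p : ℝ) ^ (n - k))⁻¹ * cov = (γ * s ^ 2) ^ n / p ^ (n - k) := by
      rw [hcov']; field_simp
    rw [h1, h2, mul_pow, mul_pow]
    have hX : 0 < (γ * s ^ 2) ^ n := by positivity
    have hpp : 0 < (p : ℝ) ^ (n - k) := by positivity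
    rw [div_div_eq_mul_div, div_le_iff₀ hX, div_mul_eq_mul_div, div_le_iff₀ (hmn.trans_le hZ)]
    have hq : 0 ≤ (Real.pi * Real.exp 1 * (1 + δ) ^ 2 / (m * γ)) ^ n := by positivity
    generalize (Real.pi * Real.exp 1 * (1 + δ) ^ 2 / (m * γ)) ^ n = q at hq
    generalize (γ * s ^ 2) ^ n = X at hX
    calc q * m ^ n * X * (p : ℝ) ^ (n - k) = (p : ℝ) ^ (n - k) * q * X * m ^ n := by ring
      _ ≤ (p : ℝ) ^ (n - k) * q * X * Z := by gcongr
  have hle : ∀ j, 1 ≤ p ^ j := fun j => Nat.one_le_pow _ _ (by omega)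
  rw [← ENNReal.ofReal_natCast, ← ENNReal.ofReal_natCast, ← ENNReal.ofReal_mul (Nat.cast_nonneg _),
    ← ENNReal.ofReal_mul (Nat.cast_nonneg _)]
  refine ENNReal.ofReal_le_ofReal ((mul_le_mul_of_nonneg_left hQ (Nat.cast_nonneg _)).trans ?_)
  rw [← mul_assoc]
  refine mul_le_mul_of_nonneg_right ?_ (by positivity)
  rw [Nat.cast_sub (hle k), Nat.cast_sub (hle n)]
  push_cast
  rw [sub_mul, one_mul, ← pow_add, Nat.add_sub_cancel' hkn]
  -- `(p^k - 1) p^{n-k} = pⁿ - p^{n-k} ≤ pⁿ - 1`.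
  linarith [one_le_pow₀ hp'.le (n := n - k)]

namespace CyclicExtension

variable {n : ℕ} (E : CyclicExtension n)

/-- Some lattice of the ensemble has a small error probability whenever its volume-to-noise ratio
is at least `γ`. -/
theorem exists_ensemble_errorProb_le {Ω : Type*} [MeasurableSpace Ω] (P : Measure Ω)
    [IsProbabilityMeasure P] {h : ℕ → Ω → ℂ} {μ : ℝ} (hh : IsErgodicFading P h μ) {k : ℕ}
    (hk : 0 < k) (hkn : k < n) {β : ℝ} (hβ : 0 < β) {γ δ : ℝ} (hγ : 0 < γ) (hδ : 0 < δ) (ε : ℝ)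
    {η : ENNReal} (hη : η ≠ 0) :
    ∃ (p : ℕ) (L : Submodule ℤ (Fin n → ℂ)), L ∈ E.ensemble k p β ∧ IsFullLattice L ∧
      ∀ s, 0 < s → γ ≤ vnr L s → errorProb P h L s ≤
        η + P {ω | ε < |(1 / (n : ℝ)) * ∑ i ∈ Finset.range n, Real.log ‖h i ω‖ - μ|} +
          (ENNReal.ofReal (((1 + δ) * Real.exp (-δ)) ^ n) + ENNReal.ofReal
            ((Real.pi * Real.exp 1 * (1 + δ) ^ 2 / (Real.exp (2 * (μ - ε)) * γ)) ^ n)) := by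
  have hn : 0 < n := hk.trans hkn
  have hn' : (0 : ℝ) < n := by exact_mod_cast hn
  obtain ⟨D, hD0, hD⟩ := E.exists_packingBound hn
  obtain ⟨B, hB, G₁, hG₁, hPG₁, hGB⟩ := exists_truncation P hh.measurable hh.ne_zero n hη
  have hM := E.isFullLattice_integerLattice hn
  have := hM.1
  have : IsZLattice ℝ E.integerLattice := ⟨hM.2⟩
  set cov := ZLattice.covolume E.integerLattice with hcovdef
  have hcov : 0 < cov := ZLattice.covolume_pos _ _
  have hΔ : (discr E.K : ℝ) ≠ 0 := by exact_mod_cast discr_ne_zero E.K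
  set c : ℝ := β * (2⁻¹ ^ n * √|(discr E.K : ℝ)|) with hcdef
  have hc : 0 < c := by positivity
  -- Every normalized lattice has covolume `cov / c`, so `s₀` is the noise level at which the ratio
  -- equals `γ`. It depends on neither `p` nor the code, which allows `p` to be chosen afterwards;
  -- the value of `cov` is never needed.
  set s₀ : ℝ := √((cov / c) ^ (1 / (n : ℝ)) / γ) with hs₀def
  have hs₀ : 0 < s₀ := by positivity
  have hs₀sq : γ * s₀ ^ 2 = (cov / c) ^ (1 / (n : ℝ)) := by
    rw [hs₀def, Real.sq_sqrt (by positivity)]; field_simp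
  have hV : cov / c = (γ * s₀ ^ 2) ^ n := by
    rw [hs₀sq, ← Real.rpow_natCast, ← Real.rpow_mul (by positivity), one_div,
      inv_mul_cancel₀ hn'.ne', Real.rpow_one]
  set R : ℝ := n * s₀ ^ 2 * (1 + δ) with hRdef
  have hR : 0 < R := by positivity
  have hRR' : √R < √(R * (1 + δ)) := Real.sqrt_lt_sqrt hR.le (by nlinarith)
  -- The largest scale at which a faded cell fits in the gap between the radii `√R` and `√(R (1 +
  -- δ))`.
  set τ : ℝ := (√(R * (1 + δ)) - √R) / (√n * B * D) with hτdef
  have hτ : 0 < τ := div_pos (sub_pos.2 hRR') (by positivity)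
  -- With `a^{2n} = (c p^{n-k})⁻¹`, the first bound gives `a ≤ τ` because `k < n`, and the second
  -- excludes points with zero residues because `k > 0`.
  obtain ⟨p₀, hp₀⟩ := exists_nat_ge (max (1 / (c * τ ^ (2 * n))) ((2 * √R * B) ^ (2 * n) * c))
  obtain ⟨p, hp, hpp₀, hsplit, ψ, hψ⟩ := E.exists_splits p₀
  have : Fact p.Prime := ⟨hp⟩
  have hp1 : (1 : ℝ) ≤ p := by exact_mod_cast hp.one_lt.le
  have hp₀' : max (1 / (c * τ ^ (2 * n))) ((2 * √R * B) ^ (2 * n) * c) < p :=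
    hp₀.trans_lt (by exact_mod_cast hpp₀)
  obtain ⟨U, _, C, hUcard, hCk, hCbal⟩ := exists_balanced_codes p hn hkn.le
  set a := E.normFactor k p β with hadef
  have ha : 0 < a := E.normFactor_pos hβ hp.pos
  have hapow : a ^ (2 * n) = (c * p ^ (n - k))⁻¹ := E.normFactor_pow hkn.le hn hβ hp.pos
  have hpj : ∀ j, 0 < j → (p : ℝ) ≤ p ^ j := fun j hj => le_self_pow₀ hp1 hj.ne'
  have haτ : a ≤ τ := by
    refine (pow_le_pow_iff_left₀ ha.le hτ.le (n := 2 * n) (by omega)).1 ?_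
    have h1 := (le_max_left _ _).trans_lt hp₀' |>.le.trans (hpj (n - k) (by omega))
    rw [div_le_iff₀ (by positivity)] at h1
    rw [hapow, inv_le_iff_one_le_mul₀ (by positivity)]
    linarith
  have hR' : √R + √n * (B * (a * D)) ≤ √(R * (1 + δ)) := by
    have h1 := (le_div_iff₀ (by positivity)).1 haτ
    linarith
  have hker : (2 * √R / (a * B⁻¹)) ^ (2 * n) < (p : ℝ) ^ n := by
    rw [show 2 * √R / (a * B⁻¹) = 2 * √R * B / a by field_simp, div_pow, hapow, div_inv_eq_mul,
      ← mul_assoc]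
    calc (2 * √R * B) ^ (2 * n) * c * (p : ℝ) ^ (n - k) < p ^ k * p ^ (n - k) := by
          refine mul_lt_mul_of_pos_right ?_ (by positivity)
          exact ((le_max_right _ _).trans_lt hp₀').trans_le (hpj k hk)
      _ = p ^ n := by rw [← pow_add, Nat.add_sub_cancel' hkn.le]
  set G₂ : Set Ω := {ω | ε < |(1 / (n : ℝ)) * ∑ i ∈ Finset.range n, Real.log ‖h i ω‖ - μ|} with hG₂def
  have hG₂ : MeasurableSet G₂ := by
    have hm : ∀ i, Measurable fun ω => Real.log ‖h i ω‖ := fun i =>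
      Real.measurable_log.comp (hh.measurable i).norm
    refine measurableSet_lt measurable_const ?_
    exact continuous_abs.measurable.comp (((Finset.measurable_sum _ fun i _ => hm i).const_mul
      (1 / (n : ℝ))).sub_const μ)
  have hUpos : 0 < Fintype.card U := by
    rw [hUcard]
    exact Nat.sub_pos_of_lt (Nat.one_lt_pow hn.ne' hp.one_lt)
  have : Nonempty U := Fintype.card_pos_iff.1 hUpos
  obtain ⟨u, hu⟩ := exists_lintegral_le P
    (fun u ω => noise n s₀ (voronoiRegion (faded (fun i => h i ω) (a • E.codeLattice ψ (C u))) 0)ᶜ)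
    (fun _ _ => prob_le_one) (hG₁.inter hG₂.compl)
    (q := ENNReal.ofReal (((1 + δ) * Real.exp (-δ)) ^ n) + ENNReal.ofReal
      ((Real.pi * Real.exp 1 * (1 + δ) ^ 2 / (Real.exp (2 * (μ - ε)) * γ)) ^ n)) fun ω hω => by
      have hb : ∀ i : Fin n, B⁻¹ ≤ ‖h i ω‖ ∧ ‖h i ω‖ ≤ B := fun i => hGB ω hω.1 i i.2
      have h1 := E.sum_noise_le hn ψ hψ (s := s₀) hCbal hD0 hD ha (inv_pos.2 hB) hB hR hker hR'
        (c := fun i => h i ω) hb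
      refine h1.trans ?_
      rw [mul_add (Fintype.card U : ENNReal)]
      refine add_le_add (mul_le_mul_right (noise_tail_le n hs₀ hδ) _) ?_
      rw [hUcard, hapow]
      exact union_bound_le hn hkn.le hp.one_lt hcov hc hs₀ hγ hδ (Real.exp_pos _) hV
        (exp_le_prod_sq_norm hn (fun i hi => norm_pos_iff.1
          ((inv_pos.2 hB).trans_le (hGB ω hω.1 i hi).1)) (not_lt.1 hω.2))
  refine ⟨p, a • E.codeLattice ψ (C u), ⟨hp, hsplit, RingHom.ker ψ, ker_mem_primesOver ψ, _, C u,
    hCk u, rfl⟩, E.isFullLattice_smul_codeLattice hn ψ (C u) ha, fun s hs hvnr => ?_⟩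
  have hss₀ : s ≤ s₀ := by
    have hp0 : (p : ℝ) ^ (n - k) ≠ 0 := by positivity
    have hcovL : ZLattice.covolume (a • E.codeLattice ψ (C u)) = cov / c := by
      rw [E.covolume_smul_codeLattice hn ψ hψ (C u) ha, hCk u, hapow, mul_inv, ← hcovdef]
      field_simp
    rw [vnr, hcovL, le_div_iff₀ (by positivity), ← hs₀sq] at hvnr
    exact (sq_le_sq₀ hs.le hs₀.le).1 (le_of_mul_le_mul_left hvnr hγ)
  refine (errorProb_mono P h _ hs hss₀).trans (hu.trans ?_)
  refine add_le_add ?_ le_rfl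
  rw [Set.compl_inter, compl_compl]
  exact (measure_union_le _ _).trans (add_le_add hPG₁ le_rfl)

end CyclicExtension

/-! ### Diagonal choice of the lattices -/

/-- If `Q j m` holds from `j = J m` on, take for `φ j` the largest `m ≤ j` with `J m ≤ j`. -/
theorem exists_diagonal {Q : ℕ → ℕ → Prop} (hQ : ∀ m, ∀ᶠ j in atTop, Q j m) :
    ∃ φ : ℕ → ℕ, Tendsto φ atTop atTop ∧ ∀ᶠ j in atTop, Q j (φ j) := by
  simp only [eventually_atTop] at hQ
  choose J hJ using hQ
  refine ⟨fun j => Nat.findGreatest (fun m => J m ≤ j) j, tendsto_atTop.2 fun M => ?_, ?_⟩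
  · filter_upwards [eventually_ge_atTop (max M (J M))] with j hj
    exact Nat.le_findGreatest ((le_max_left _ _).trans hj) ((le_max_right _ _).trans hj)
  · filter_upwards [eventually_ge_atTop (J 0)] with j hj
    exact hJ _ _ (Nat.findGreatest_spec (P := fun m => J m ≤ j) (Nat.zero_le j) hj)

/-- At `t = 0` the inequality is the threshold condition, and continuity leaves room for a positive
`t`, which serves as both `δ` and `ε`. -/
theorem exists_margin {μ γ : ℝ} (hγ : Real.exp (-2 * μ) * (Real.pi * Real.exp 1) < γ) :
    ∃ t : ℝ, 0 < t ∧
      Real.pi * Real.exp 1 * (1 + t) ^ 2 / (Real.exp (2 * (μ - t)) * γ) < 1 := by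
  have hγ0 : 0 < γ := lt_trans (by positivity) hγ
  have hcont : Continuous fun t : ℝ =>
      Real.pi * Real.exp 1 * (1 + t) ^ 2 / (Real.exp (2 * (μ - t)) * γ) :=
    Continuous.div (by fun_prop) (by fun_prop) fun t => by positivity
  have h0 : Real.pi * Real.exp 1 * (1 + 0) ^ 2 / (Real.exp (2 * (μ - 0)) * γ) < 1 := by
    rw [div_lt_one (by positivity)]
    have h1 : Real.exp (2 * μ) * Real.exp (-2 * μ) = 1 := by
      rw [← Real.exp_add]; simp
    have h2 := mul_lt_mul_of_pos_left hγ (Real.exp_pos (2 * μ))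
    rw [← mul_assoc, h1, one_mul] at h2
    simpa using h2
  obtain ⟨t, ht, ht0⟩ := ((hcont.continuousAt.eventually_lt_const h0).filter_mono
    nhdsWithin_le_nhds |>.and (self_mem_nhdsWithin (s := Set.Ioi (0 : ℝ)))).exists
  exact ⟨t, ht0, ht⟩

theorem tendsto_ofReal_pow_comp {n : ℕ → ℕ} (hn : StrictMono n) {r : ℝ} (h0 : 0 ≤ r) (h1 : r < 1) :
    Tendsto (fun j => ENNReal.ofReal (r ^ n j)) atTop (𝓝 0) := by
  rw [← ENNReal.ofReal_zero]
  exact ENNReal.tendsto_ofReal ((tendsto_pow_atTop_nhds_zero_of_lt_one h0 h1).comp hn.tendsto_atTop)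

/-- Above the threshold, the error probability is eventually small for some lattice. -/
theorem eventually_exists_errorProb_le {Ω : Type*} [MeasurableSpace Ω] (P : Measure Ω)
    [IsProbabilityMeasure P] {h : ℕ → Ω → ℂ} {μ : ℝ} (hh : IsErgodicFading P h μ) {β : ℝ}
    (hβ : 0 < β) {n k : ℕ → ℕ} (hn : StrictMono n) (hk : ∀ j, 0 < k j ∧ k j < n j)
    (E : ∀ j, CyclicExtension (n j)) {γ : ℝ}
    (hγ : Real.exp (-2 * μ) * (Real.pi * Real.exp 1) < γ) {r : ENNReal} (hr : r ≠ 0) :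
    ∀ᶠ j in atTop, ∃ (p : ℕ) (L : Submodule ℤ (Fin (n j) → ℂ)), L ∈ (E j).ensemble (k j) p β ∧
      IsFullLattice L ∧ ∀ s, 0 < s → γ ≤ vnr L s → errorProb P h L s ≤ r := by
  have hγ0 : 0 < γ := lt_trans (by positivity) hγ
  obtain ⟨t, ht, ht1⟩ := exists_margin hγ
  have hδ1 : (1 + t) * Real.exp (-t) < 1 := by
    have h1 := Real.add_one_lt_exp ht.ne'
    rw [Real.exp_neg, ← div_eq_mul_inv, div_lt_one (Real.exp_pos t)]
    linarith
  have hlim := ((hh.weak_law t ht).comp hn.tendsto_atTop).add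
    ((tendsto_ofReal_pow_comp hn (by positivity) hδ1).add
      (tendsto_ofReal_pow_comp hn (by positivity) ht1))
  simp only [add_zero] at hlim
  have hr2 : r / 2 ≠ 0 := (ENNReal.half_pos hr).ne'
  filter_upwards [hlim.eventually_le_const (pos_iff_ne_zero.2 hr2)] with j hj
  obtain ⟨p, L, hL, hfull, hs⟩ := (E j).exists_ensemble_errorProb_le P hh (hk j).1 (hk j).2 hβ hγ0
    ht t hr2
  refine ⟨p, L, hL, hfull, fun s hs0 hv => (hs s hs0 hv).trans ?_⟩
  rw [add_assoc]
  exact (add_le_add le_rfl hj).trans_eq (ENNReal.add_halves r)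

theorem mainTheorem10 {Ω : Type*} [MeasurableSpace Ω] (P : Measure Ω) [IsProbabilityMeasure P]
    (h : ℕ → Ω → ℂ) (μ : ℝ) (hh : IsErgodicFading P h μ)
    (β : ℝ) (hβ : 0 < β)
    (n k : ℕ → ℕ) (hn : StrictMono n) (hk : ∀ j, 0 < k j ∧ k j < n j) :
    (∀ j, Nonempty (CyclicExtension (n j))) ∧
    ∀ E : ∀ j, CyclicExtension (n j),
      ∃ (p : ℕ → ℕ) (L : ∀ j, Submodule ℤ (Fin (n j) → ℂ)),
        (∀ j, L j ∈ (E j).ensemble (k j) (p j) β) ∧ FadingGood P h μ n L := by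
  refine ⟨fun j => nonempty_cyclicExtension ((hk j).1.trans (hk j).2), fun E => ?_⟩
  set γ₀ : ℝ := Real.exp (-2 * μ) * (Real.pi * Real.exp 1) with hγ₀
  -- Level `m` asks for error at most `1/(m+1)` at margin `1/(m+1)` above the threshold; levels
  -- tending to infinity cover every `γ > γ₀`.
  let Good : ∀ j, ℕ → Submodule ℤ (Fin (n j) → ℂ) → Prop := fun j m L =>
    ∀ s, 0 < s → γ₀ + 1 / ((m : ℝ) + 1) ≤ vnr L s → errorProb P h L s ≤ ((m : ENNReal) + 1)⁻¹
  obtain ⟨φ, hφ, hgood⟩ := exists_diagonal (Q := fun j m => ∃ (p : ℕ)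
    (L : Submodule ℤ (Fin (n j) → ℂ)), L ∈ (E j).ensemble (k j) p β ∧ IsFullLattice L ∧ Good j m L)
    fun m => eventually_exists_errorProb_le P hh hβ hn hk E (lt_add_of_pos_right γ₀ (by positivity))
      (ENNReal.inv_ne_zero.2 (by finiteness))
  have hex : ∀ j, ∃ (p : ℕ) (L : Submodule ℤ (Fin (n j) → ℂ)), L ∈ (E j).ensemble (k j) p β ∧
      IsFullLattice L ∧ ((∃ (p : ℕ) (L : Submodule ℤ (Fin (n j) → ℂ)),
        L ∈ (E j).ensemble (k j) p β ∧ IsFullLattice L ∧ Good j (φ j) L) → Good j (φ j) L) :=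
    fun j => by
      by_cases hj : ∃ (p : ℕ) (L : Submodule ℤ (Fin (n j) → ℂ)),
          L ∈ (E j).ensemble (k j) p β ∧ IsFullLattice L ∧ Good j (φ j) L
      · obtain ⟨p, L, h1, h2, h3⟩ := hj
        exact ⟨p, L, h1, h2, fun _ => h3⟩
      -- For the finitely many exceptional `j` any full lattice of the ensemble will do; the
      -- parameters are arbitrary.
      · obtain ⟨p, L, h1, h2, -⟩ := (E j).exists_ensemble_errorProb_le P hh (hk j).1 (hk j).2 hβ
          one_pos one_pos 1 one_ne_zero
        exact ⟨p, L, h1, h2, fun h3 => absurd h3 hj⟩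
  choose p L hL hfull hLgood using hex
  refine ⟨p, L, hL, hn, hfull, fun γ hγ s hs hv => ?_⟩
  have hγφ : ∀ᶠ j in atTop, γ₀ + 1 / ((φ j : ℝ) + 1) ≤ γ := by
    have h1 := (tendsto_one_div_add_atTop_nhds_zero_nat (𝕜 := ℝ)).comp hφ
    filter_upwards [h1.eventually_le_const (sub_pos.2 hγ)] with j hj
    have hj' : 1 / ((φ j : ℝ) + 1) ≤ γ - γ₀ := hj
    linarith
  have hinv : Tendsto (fun j => ((φ j : ENNReal) + 1)⁻¹) atTop (𝓝 0) := by
    have h1 := ENNReal.tendsto_inv_nat_nhds_zero.comp ((tendsto_add_atTop_nat 1).comp hφ)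
    refine h1.congr fun j => ?_
    simp
  refine tendsto_of_tendsto_of_tendsto_of_le_of_le' tendsto_const_nhds hinv
    (Eventually.of_forall fun _ => zero_le) ?_
  filter_upwards [hγφ, hgood] with j hj hjg
  exact hLgood j hjg (s j) (hs j) (hj.trans (hv j))
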